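/- Let $\ell, T, \kappa, \tau, \xi > 0$ and $\alpha \in \mathbb{R}$. Let $H^2_E(0,\ell) = \{ y \in H^2(0,\ell) : y(0) = y'(0) = 0 \}$ and let $\mathscr{H} = H^2_E(0,\ell) \times L^2(0,\ell) \times L^2((0,\ell)\times(0,1))$ (real-valued functions) be the Hilbert space with the inner product $$\langle (y_1,v_1,u_1),(y_2,v_2,u_2)\rangle = \int_0^\ell v_1 v_2\,dx + T\int_0^\ell y_1' y_2'\,dx + \int_0^\ell y_1'' y_2''\,dx + \xi \int_0^\ell\!\int_0^1 u_1 u_2\,ds\,dx .$$ Let $\mathbb{A} : \mathscr{D}(\mathbb{A}) \subset \mathscr{H} \to \mathscr{H}$ be the linear operator whose domain $\mathscr{D}(\mathbb{A})$ consists of all $(y,v,u) \in \mathscr{H}$ with $y \in H^4(0,\ell)$, $v \in H^2_E(0,\ell)$, $u \in L^2(0,\ell; H^1(0,1))$, $v = u(\cdot,0)$, $y''(\ell) = 0$ and $y'''(\ell) - T y'(\ell) = \kappa v(\ell)$, and which is given by $$\mathbb{A}(y,v,u) = \bigl(v,\; -y^{(4)} + T y'' - \alpha u(\cdot,1),\;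 -\tau^{-1} u_s\bigr).$$ (It governs the Euler–Bernoulli beam $y_{tt} + y_{xxxx} - T y_{xx} + \alpha y_t(x,t-\tau) = 0$ on $(0,\ell)$ with $y(0,t) = y_x(0,t) = y_{xx}(\ell,t) = 0$ and $y_{xxx}(\ell,t) - T y_x(\ell,t) = \kappa y_t(\ell,t)$, written for $Y = (y, y_t, u)$ with $u(x,s,t) = y_t(x,t-\tau s)$.) Then $\mathbb{A}$ generates a $C_0$-semigroup $(S(t))_{t \ge 0}$ on $\mathscr{H}$. Consequently, for every $Y_0 \in \mathscr{H}$ the problem $Y'(t) = \mathbb{A}Y(t)$, $Y(0) = Y_0$ has a unique mild solution $Y \in C([0,\infty),\mathscr{H})$, that is, a unique continuous $Y$ such that $\int_0^t Y(r)\,dr \in \mathscr{D}(\mathbb{A})$ and $Y(t) = Y_0 + \mathbb{A}\int_0^t Y(r)\,dr$ for all $t \ge 0$; it is given by $Y(t) = S(t)Y_0$. If moreover $Y_0 \in \mathscr{D}(\mathbb{A})$, then $Y$ is a classical solution, and $Y \in C([0,\infty),\mathscr{D}(\mathbb{A})) \cap C^1([0,\infty),\mathscr{H})$, where $\mathscr{D}(\mathbb{A})$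 carries the graph norm. -/

import Mathlib

open MeasureTheory Set Filter Topology
open scoped ContDiff NNReal

noncomputable section

namespace Beam

/-! ### Sobolev spaces on a bounded open interval -/

/-- The Lebesgue measure on the open interval `(a, b)`. -/
abbrev leb (a b : ℝ) : Measure ℝ := volume.restrict (Ioo a b)

/-- The real Hilbert space `L²(a, b)`. -/
abbrev L2 (a b : ℝ) : Type := Lp ℝ 2 (leb a b)

/-- Test functions: smooth functions with compact support contained in `(a, b)`. -/
def IsTest (a b : ℝ) (φ : ℝ → ℝ) : Prop :=
  ContDiff ℝ ∞ φ ∧ HasCompactSupport φ ∧ tsupport φ ⊆ Ioo a b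

/-- `g` is a weak derivative of `f` on `(a, b)`, both being integrable on `(a, b)`. -/
def HasWeakDeriv (a b : ℝ) (f g : ℝ → ℝ) : Prop :=
  Integrable f (leb a b) ∧ Integrable g (leb a b) ∧
    ∀ φ : ℝ → ℝ, IsTest a b φ →
      ∫ x in Ioo a b, f x * deriv φ x = - ∫ x in Ioo a b, g x * φ x

/-- `F` is a continuous representative on `[a, b]` of the function `f` on `(a, b)`. -/
def IsContRep (a b : ℝ) (f F : ℝ → ℝ) : Prop :=
  ContinuousOn F (Icc a b) ∧ f =ᵐ[leb a b] F

open Classical in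
/-- The continuous representative on `[a, b]` of `f` (zero if there is none). Boundary values and
point values are those of this representative. -/
def contRep (a b : ℝ) (f : ℝ → ℝ) : ℝ → ℝ :=
  if h : ∃ F, IsContRep a b f F then h.choose else 0

section basic

variable {a b : ℝ}

theorem IsTest.deriv {φ : ℝ → ℝ} (h : IsTest a b φ) : IsTest a b (deriv φ) :=
  ⟨(contDiff_infty_iff_deriv.1 h.1).2, h.2.1.deriv, (closure_minimal support_deriv_subset (isClosed_tsupport φ)).trans h.2.2⟩

theorem IsTest.integrable_mul {f φ : ℝ → ℝ} (hf : Integrable f (leb a b)) (h : IsTest a b φ) :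
    Integrable (fun x => f x * φ x) (leb a b) := by
  obtain ⟨C, hC⟩ := h.2.1.exists_bound_of_continuous h.1.continuous
  exact hf.mul_bdd h.1.continuous.aestronglyMeasurable (Eventually.of_forall hC)

theorem L2.integrable (f : L2 a b) : Integrable f (leb a b) :=
  (Lp.memLp f).integrable one_le_two

theorem HasWeakDeriv.congr {f g f₁ g₁ : ℝ → ℝ} (h : HasWeakDeriv a b f g)
    (hf : f₁ =ᵐ[leb a b] f) (hg : g₁ =ᵐ[leb a b] g) : HasWeakDeriv a b f₁ g₁ := by
  refine ⟨h.1.congr hf.symm, h.2.1.congr hg.symm, fun φ hφ => ?_⟩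
  have h1 : ∫ x in Ioo a b, f₁ x * _root_.deriv φ x = ∫ x in Ioo a b, f x * _root_.deriv φ x :=
    integral_congr_ae (by filter_upwards [hf] with x hx; rw [hx])
  have h2 : ∫ x in Ioo a b, g₁ x * φ x = ∫ x in Ioo a b, g x * φ x :=
    integral_congr_ae (by filter_upwards [hg] with x hx; rw [hx])
  rw [h1, h2, h.2.2 φ hφ]

theorem HasWeakDeriv.add {f g f₁ g₁ : ℝ → ℝ} (h : HasWeakDeriv a b f g)
    (h₁ : HasWeakDeriv a b f₁ g₁) :
    HasWeakDeriv a b (fun x => f x + f₁ x) (fun x => g x + g₁ x) := by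
  refine ⟨h.1.add h₁.1, h.2.1.add h₁.2.1, fun φ hφ => ?_⟩
  simp only [add_mul]
  rw [integral_add (hφ.deriv.integrable_mul h.1) (hφ.deriv.integrable_mul h₁.1),
    integral_add (hφ.integrable_mul h.2.1) (hφ.integrable_mul h₁.2.1),
    h.2.2 φ hφ, h₁.2.2 φ hφ]
  ring

theorem HasWeakDeriv.smul {f g : ℝ → ℝ} (c : ℝ) (h : HasWeakDeriv a b f g) :
    HasWeakDeriv a b (fun x => c * f x) (fun x => c * g x) := by
  refine ⟨h.1.const_mul c, h.2.1.const_mul c, fun φ hφ => ?_⟩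
  simp only [mul_assoc, integral_const_mul]
  rw [h.2.2 φ hφ]
  ring

theorem HasWeakDeriv.zero : HasWeakDeriv a b (fun _ => 0) (fun _ => 0) :=
  ⟨integrable_zero _ _ _, integrable_zero _ _ _, fun φ _ => by simp⟩

theorem ae_zero_of_test {f : ℝ → ℝ} (hf : Integrable f (leb a b))
    (h : ∀ φ, IsTest a b φ → ∫ x in Ioo a b, f x * φ x = 0) : f =ᵐ[leb a b] 0 := by
  have := isOpen_Ioo.ae_eq_zero_of_integral_contDiff_smul_eq_zero (f := f) (μ := volume)
    (U := Ioo a b) (IntegrableOn.locallyIntegrableOn hf) (fun g h1 h2 h3 => by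
      rw [← h g ⟨h1, h2, h3⟩, ← setIntegral_eq_integral_of_forall_compl_eq_zero (s := Ioo a b)]
      · simp only [smul_eq_mul, mul_comm]
      · intro x hx
        rw [image_eq_zero_of_notMem_tsupport (fun hx' => hx (h3 hx')), zero_smul])
  exact (ae_restrict_iff' measurableSet_Ioo).2 this

theorem HasWeakDeriv.unique {f g g₁ : ℝ → ℝ} (h : HasWeakDeriv a b f g)
    (h₁ : HasWeakDeriv a b f g₁) : g =ᵐ[leb a b] g₁ := by
  have := ae_zero_of_test (f := fun x => g x - g₁ x) (h.2.1.sub h₁.2.1) (fun φ hφ => by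
    simp only [sub_mul]
    rw [integral_sub (hφ.integrable_mul h.2.1) (hφ.integrable_mul h₁.2.1)]
    linarith [h.2.2 φ hφ, h₁.2.2 φ hφ])
  filter_upwards [this] with x hx
  simpa [sub_eq_zero] using hx

theorem contRep_eqOn (hab : a < b) {f F : ℝ → ℝ} (h : IsContRep a b f F) :
    EqOn (contRep a b f) F (Icc a b) := by
  have hex : ∃ F, IsContRep a b f F := ⟨F, h⟩
  have h1 : contRep a b f = hex.choose := dif_pos hex
  have hs := hex.choose_spec
  rw [h1]
  refine Measure.eqOn_Icc_of_ae_eq volume hab.ne ?_ hs.1 h.1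
  rw [← restrict_Ioo_eq_restrict_Icc]
  exact hs.2.symm.trans h.2

theorem IsContRep.congr {f f₁ F : ℝ → ℝ} (h : IsContRep a b f F) (hf : f₁ =ᵐ[leb a b] f) :
    IsContRep a b f₁ F := ⟨h.1, hf.trans h.2⟩

theorem IsContRep.add {f F f₁ F₁ : ℝ → ℝ} (h : IsContRep a b f F) (h₁ : IsContRep a b f₁ F₁) :
    IsContRep a b (fun x => f x + f₁ x) (fun x => F x + F₁ x) :=
  ⟨h.1.add h₁.1, by filter_upwards [h.2, h₁.2] with x h1 h2; rw [h1, h2]⟩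

theorem IsContRep.smul {f F : ℝ → ℝ} (c : ℝ) (h : IsContRep a b f F) :
    IsContRep a b (fun x => c * f x) (fun x => c * F x) :=
  ⟨continuousOn_const.mul h.1, by filter_upwards [h.2] with x h1; rw [h1]⟩

theorem HasWeakDeriv.of_primitive (hab : a < b) {g : ℝ → ℝ} (hg : Integrable g (leb a b)) :
    HasWeakDeriv a b (fun x => ∫ t in a..x, g t) g := by
  have hi : IntervalIntegrable g volume a b := by
    rw [intervalIntegrable_iff_integrableOn_Ioo_of_le hab.le]; exact hg
  have hac : AbsolutelyContinuousOnInterval (fun x => ∫ t in a..x, g t) a b :=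
    hi.absolutelyContinuousOnInterval_intervalIntegral left_mem_uIcc
  have hc : ContinuousOn (fun x => ∫ t in a..x, g t) (Icc a b) := by
    simpa [uIcc_of_le hab.le] using hac.continuousOn
  have hint : IntegrableOn (fun x => ∫ t in a..x, g t) (Ioo a b) :=
    hc.integrableOn_Icc.mono_set Ioo_subset_Icc_self
  refine ⟨hint, hg, fun φ hφ => ?_⟩
  have hφac : AbsolutelyContinuousOnInterval φ a b :=
    (hφ.1.of_le (m := 1) (by exact_mod_cast (le_top : (1 : ℕ∞) ≤ ⊤))).contDiffOn.absolutelyContinuousOnInterval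
  have key := hac.integral_mul_deriv_eq_deriv_mul hφac
  have ha : φ a = 0 := image_eq_zero_of_notMem_tsupport fun h => (lt_irrefl (a : ℝ)) (hφ.2.2 h).1
  have hb : φ b = 0 := image_eq_zero_of_notMem_tsupport fun h => lt_irrefl b (hφ.2.2 h).2
  rw [intervalIntegral.integral_of_le hab.le, intervalIntegral.integral_of_le hab.le,
    integral_Ioc_eq_integral_Ioo, integral_Ioc_eq_integral_Ioo, ha, hb] at key
  rw [key]
  simp only [mul_zero, sub_zero, zero_sub, neg_inj]
  rw [intervalIntegral.integral_of_le hab.le, integral_Ioc_eq_integral_Ioo]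
  refine setIntegral_congr_ae (measurableSet_Ioo (a := a) (b := b)) ?_
  filter_upwards [hi.ae_hasDerivAt_integral] with x hx hxm
  rw [(hx (by rw [uIcc_of_le hab.le]; exact Ioo_subset_Icc_self hxm) a left_mem_uIcc).deriv]

/-- A function with vanishing weak derivative is constant. -/
theorem HasWeakDeriv.ae_const (hab : a < b) {f : ℝ → ℝ} (h : HasWeakDeriv a b f (fun _ => 0)) :
    ∃ c : ℝ, f =ᵐ[leb a b] fun _ => c := by
  have hr : 0 < (b - a) / 4 := by linarith
  let B : ContDiffBump ((a + b) / 2) := ⟨(b - a) / 8, (b - a) / 4, by linarith, by linarith⟩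
  have hBs : tsupport B = Metric.closedBall ((a + b) / 2) ((b - a) / 4) := B.tsupport_eq
  have hBt : IsTest a b B := by
    refine ⟨B.contDiff, B.hasCompactSupport, ?_⟩
    rw [hBs, Real.closedBall_eq_Icc]
    intro x hx
    constructor <;> linarith [hx.1, hx.2]
  have hset : ∀ ψ, IsTest a b ψ → ∫ x in Ioo a b, ψ x = ∫ x, ψ x := fun ψ hψ =>
    setIntegral_eq_integral_of_forall_compl_eq_zero fun x hx =>
      image_eq_zero_of_notMem_tsupport fun h => hx (hψ.2.2 h)
  set m : ℝ := ∫ x in Ioo a b, B x with hm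
  have hm0 : m ≠ 0 := by
    rw [hm, hset B hBt]; exact B.integral_pos.ne'
  set c : ℝ := (∫ x in Ioo a b, f x * B x) / m with hc
  refine ⟨c, ?_⟩
  have main : (fun x => f x - c) =ᵐ[leb a b] 0 := by
    refine ae_zero_of_test (h.1.sub (integrable_const c)) fun ψ hψ => ?_
    set k : ℝ := (∫ x in Ioo a b, ψ x) / m with hk
    set η : ℝ → ℝ := fun x => ψ x - k * B x with hη
    have hηd : ContDiff ℝ ∞ η := hψ.1.sub (contDiff_const.mul hBt.1)
    set φ : ℝ → ℝ := fun x => ∫ t in a..x, η t with hφ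
    have hφ' : ∀ x, HasDerivAt φ (η x) x := fun x =>
      intervalIntegral.integral_hasDerivAt_right (hηd.continuous.intervalIntegrable _ _)
        (hηd.continuous.stronglyMeasurableAtFilter _ _) hηd.continuous.continuousAt
    have hφd : deriv φ = η := funext fun x => (hφ' x).deriv
    obtain ⟨p, q, hap, hqb, hpq⟩ : ∃ p q, a < p ∧ q < b ∧ ∀ x, x ∉ Icc p q → η x = 0 := by
      have hK : IsCompact (tsupport ψ ∪ tsupport B) := hψ.2.1.isCompact.union hBt.2.1.isCompact
      have hne : (tsupport ψ ∪ tsupport B).Nonempty :=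
        ⟨(a + b) / 2, Or.inr (by rw [hBs]; exact Metric.mem_closedBall_self hr.le)⟩
      obtain ⟨p, hp⟩ := hK.exists_isLeast hne
      obtain ⟨q, hq⟩ := hK.exists_isGreatest hne
      have hsub : tsupport ψ ∪ tsupport B ⊆ Ioo a b := union_subset hψ.2.2 hBt.2.2
      refine ⟨p, q, (hsub hp.1).1, (hsub hq.1).2, fun x hx => ?_⟩
      have hx1 : x ∉ tsupport ψ := fun h' => hx ⟨hp.2 (Or.inl h'), hq.2 (Or.inl h')⟩
      have hx2 : x ∉ tsupport B := fun h' => hx ⟨hp.2 (Or.inr h'), hq.2 (Or.inr h')⟩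
      simp [hη, image_eq_zero_of_notMem_tsupport hx1, image_eq_zero_of_notMem_tsupport hx2]
    have hηi : ∫ x in Ioo a b, η x = 0 := by
      have h1 : Integrable ψ (leb a b) :=
        (hψ.1.continuous.integrable_of_hasCompactSupport hψ.2.1).integrableOn
      have h2 : Integrable B (leb a b) :=
        (hBt.1.continuous.integrable_of_hasCompactSupport hBt.2.1).integrableOn
      simp only [hη]
      rw [integral_sub h1 (h2.const_mul k), integral_const_mul, ← hm, hk]
      field_simp
      ring
    have hφz : ∀ x, x ∉ Icc p q → φ x = 0 := by
      intro x hx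
      rw [mem_Icc, not_and_or, not_le, not_le] at hx
      rcases hx with hx | hx
      · refine intervalIntegral.integral_zero_ae (Eventually.of_forall fun t ht => hpq t fun htm => ?_)
        have h1 : t ≤ max a x := ht.2
        exact absurd (htm.1.trans h1) (not_le.2 (max_lt hap hx))
      · have h1 : ∫ t in a..b, η t = 0 := by
          rw [intervalIntegral.integral_of_le hab.le, integral_Ioc_eq_integral_Ioo, hηi]
        have h2 : ∫ t in b..x, η t = 0 := by
          refine intervalIntegral.integral_zero_ae
            (Eventually.of_forall fun t ht => hpq t fun htm => ?_)
          have h1 : min b x < t := ht.1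
          exact absurd (h1.trans_le htm.2) (not_lt.2 (lt_min hqb hx).le)
        simp only [hφ]
        rw [← intervalIntegral.integral_add_adjacent_intervals
          (hηd.continuous.intervalIntegrable a b) (hηd.continuous.intervalIntegrable b x), h1, h2,
          add_zero]
    have hφt : IsTest a b φ := by
      have hsup : tsupport φ ⊆ Icc p q :=
        closure_minimal (fun x hx => by_contra fun h' => hx (hφz x h')) isClosed_Icc
      refine ⟨contDiff_infty_iff_deriv.2 ⟨fun x => (hφ' x).differentiableAt, hφd ▸ hηd⟩,
        HasCompactSupport.of_support_subset_isCompact isCompact_Icc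
          ((subset_tsupport φ).trans hsup), hsup.trans fun x hx => ⟨hap.trans_le hx.1, hx.2.trans_lt hqb⟩⟩
    have e := h.2.2 φ hφt
    rw [hφd] at e
    simp only [hη, zero_mul, integral_zero, neg_zero, mul_sub] at e
    have h3 : (fun x => f x * (k * B x)) = fun x => k * (f x * B x) := by funext x; ring
    have h4 : Integrable (fun x => f x * (k * B x)) (leb a b) := by
      rw [h3]; exact (hBt.integrable_mul h.1).const_mul k
    rw [integral_sub (hψ.integrable_mul h.1) h4, h3, integral_const_mul] at e
    simp only [sub_mul]
    rw [integral_sub (hψ.integrable_mul h.1) (hψ.integrable_mul (integrable_const c)),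
      integral_const_mul]
    have : c * ∫ x in Ioo a b, ψ x = k * ∫ x in Ioo a b, f x * B x := by
      rw [hc, hk]; field_simp
    rw [this]; exact e
  filter_upwards [main] with x hx
  simpa [sub_eq_zero] using hx

/-- The fundamental theorem of calculus for weakly differentiable functions. -/
theorem HasWeakDeriv.exists_contRep (hab : a < b) {f g : ℝ → ℝ} (h : HasWeakDeriv a b f g) :
    ∃ F, IsContRep a b f F ∧ ∀ x, F x = F a + ∫ t in a..x, g t := by
  have hp := HasWeakDeriv.of_primitive hab h.2.1
  have hd : HasWeakDeriv a b (fun x => f x + (-1) * ∫ t in a..x, g t) (fun _ => 0) :=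
    (h.add (hp.smul (-1))).congr (Eventually.of_forall fun _ => rfl)
      (Eventually.of_forall fun x => by simp)
  obtain ⟨c, hc⟩ := hd.ae_const hab
  refine ⟨fun x => c + ∫ t in a..x, g t, ⟨continuousOn_const.add ?_, ?_⟩, fun x => by simp⟩
  · have hi : IntegrableOn g (uIcc a b) := by
      rw [uIcc_of_le hab.le, integrableOn_Icc_iff_integrableOn_Ioo]; exact h.2.1
    simpa [uIcc_of_le hab.le] using intervalIntegral.continuousOn_primitive_interval hi
  · filter_upwards [hc] with x hx
    linarith

end basic

/-- The Sobolev space `H^k(a, b)`, as a subspace of `L²(a, b)`: `f ∈ H^{k+1}` iff `f ∈ L²` has a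
weak derivative in `H^k`. -/
def sobolev (a b : ℝ) : ℕ → Submodule ℝ (L2 a b)
  | 0 => ⊤
  | k + 1 =>
    { carrier := {f | ∃ g ∈ sobolev a b k, HasWeakDeriv a b f g}
      add_mem' := by
        rintro f f₁ ⟨g, hg, h⟩ ⟨g₁, hg₁, h₁⟩
        exact ⟨g + g₁, add_mem hg hg₁, (h.add h₁).congr (Lp.coeFn_add _ _) (Lp.coeFn_add _ _)⟩
      zero_mem' := ⟨0, zero_mem _, HasWeakDeriv.zero.congr (Lp.coeFn_zero _ _ _)
        (Lp.coeFn_zero _ _ _)⟩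
      smul_mem' := by
        rintro c f ⟨g, hg, h⟩
        exact ⟨c • g, Submodule.smul_mem _ c hg,
          (h.smul c).congr (Lp.coeFn_smul _ _) (Lp.coeFn_smul _ _)⟩ }

open Classical in
/-- The weak derivative of `f ∈ H¹(a, b)`, as an element of `L²(a, b)` (zero for other `f`). -/
def wderiv {a b : ℝ} (f : L2 a b) : L2 a b :=
  if h : ∃ g : L2 a b, HasWeakDeriv a b f g then h.choose else 0

section sobolev

variable {a b : ℝ}

theorem mem_sobolev_succ {k : ℕ} {f : L2 a b} :
    f ∈ sobolev a b (k + 1) ↔ ∃ g ∈ sobolev a b k, HasWeakDeriv a b f g := Iff.rfl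

theorem wderiv_eq {f g : L2 a b} (h : HasWeakDeriv a b f g) : wderiv f = g := by
  have hex : ∃ g : L2 a b, HasWeakDeriv a b f g := ⟨g, h⟩
  have h1 : wderiv f = hex.choose := dif_pos hex
  rw [h1]
  exact Lp.ext (hex.choose_spec.unique h)

theorem hasWeakDeriv_wderiv {k : ℕ} {f : L2 a b} (h : f ∈ sobolev a b (k + 1)) :
    HasWeakDeriv a b f (wderiv f) := by
  obtain ⟨g, -, hg⟩ := mem_sobolev_succ.1 h
  rwa [wderiv_eq hg]

theorem wderiv_mem {k : ℕ} {f : L2 a b} (h : f ∈ sobolev a b (k + 1)) :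
    wderiv f ∈ sobolev a b k := by
  obtain ⟨g, hk, hg⟩ := mem_sobolev_succ.1 h
  rwa [wderiv_eq hg]

theorem wderiv_add {k : ℕ} {f f₁ : L2 a b} (h : f ∈ sobolev a b (k + 1))
    (h₁ : f₁ ∈ sobolev a b (k + 1)) : wderiv (f + f₁) = wderiv f + wderiv f₁ :=
  wderiv_eq (((hasWeakDeriv_wderiv h).add (hasWeakDeriv_wderiv h₁)).congr
    (Lp.coeFn_add _ _) (Lp.coeFn_add _ _))

theorem wderiv_smul {k : ℕ} {f : L2 a b} (c : ℝ) (h : f ∈ sobolev a b (k + 1)) :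
    wderiv (c • f) = c • wderiv f :=
  wderiv_eq (((hasWeakDeriv_wderiv h).smul c).congr (Lp.coeFn_smul _ _) (Lp.coeFn_smul _ _))

theorem wderiv_zero : wderiv (0 : L2 a b) = 0 :=
  wderiv_eq (HasWeakDeriv.zero.congr (Lp.coeFn_zero _ _ _) (Lp.coeFn_zero _ _ _))

theorem exists_isContRep (hab : a < b) {k : ℕ} {f : L2 a b} (h : f ∈ sobolev a b (k + 1)) :
    ∃ F, IsContRep a b f F :=
  let ⟨F, hF, _⟩ := (hasWeakDeriv_wderiv h).exists_contRep hab
  ⟨F, hF⟩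

theorem contRep_add (hab : a < b) {k : ℕ} {f f₁ : L2 a b} (h : f ∈ sobolev a b (k + 1))
    (h₁ : f₁ ∈ sobolev a b (k + 1)) {x : ℝ} (hx : x ∈ Icc a b) :
    contRep a b (f + f₁ : L2 a b) x = contRep a b f x + contRep a b f₁ x := by
  obtain ⟨F, hF⟩ := exists_isContRep hab h
  obtain ⟨F₁, hF₁⟩ := exists_isContRep hab h₁
  rw [contRep_eqOn hab hF hx, contRep_eqOn hab hF₁ hx,
    contRep_eqOn hab ((hF.add hF₁).congr (Lp.coeFn_add f f₁)) hx]

theorem contRep_smul (hab : a < b) {k : ℕ} {f : L2 a b} (c : ℝ) (h : f ∈ sobolev a b (k + 1))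
    {x : ℝ} (hx : x ∈ Icc a b) :
    contRep a b (c • f : L2 a b) x = c * contRep a b f x := by
  obtain ⟨F, hF⟩ := exists_isContRep hab h
  rw [contRep_eqOn hab hF hx, contRep_eqOn hab ((hF.smul c).congr (Lp.coeFn_smul c f)) hx]

theorem contRep_zero (hab : a < b) {x : ℝ} (hx : x ∈ Icc a b) :
    contRep a b (0 : L2 a b) x = 0 :=
  contRep_eqOn hab (F := fun _ => 0) ⟨continuousOn_const, Lp.coeFn_zero _ _ _⟩ hx

theorem ae_eq_primitive (hab : a < b) {k : ℕ} {f : L2 a b} (h : f ∈ sobolev a b (k + 1))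
    (h0 : contRep a b f a = 0) : f =ᵐ[leb a b] fun x => ∫ t in a..x, wderiv f t := by
  obtain ⟨F, hF, hF'⟩ := (hasWeakDeriv_wderiv h).exists_contRep hab
  have hFa : F a = 0 := by rw [← contRep_eqOn hab hF (left_mem_Icc.2 hab.le), h0]
  filter_upwards [hF.2] with x hx
  rw [hx, hF', hFa, zero_add]

end sobolev

/-! ### Parameters and the state space -/

/-- The parameters of the system: length `ℓ`, axial tension `T`, boundary gain `κ`, delay `τ`,
weight `ξ` of the inner product (all positive), and delay coefficient `α` (any real number). -/
structure Params where
  ℓ : ℝ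
  T : ℝ
  κ : ℝ
  τ : ℝ
  ξ : ℝ
  α : ℝ
  ℓ_pos : 0 < ℓ
  T_pos : 0 < T
  κ_pos : 0 < κ
  τ_pos : 0 < τ
  ξ_pos : 0 < ξ

/-- `H²_E(0, ℓ) = {y ∈ H²(0, ℓ) : y(0) = y'(0) = 0}`. -/
def H2E (p : Params) : Submodule ℝ (L2 0 p.ℓ) where
  carrier := {y | y ∈ sobolev 0 p.ℓ 2 ∧ contRep 0 p.ℓ y 0 = 0 ∧ contRep 0 p.ℓ (wderiv y) 0 = 0}
  add_mem' := by
    rintro y z ⟨hy, hy0, hy1⟩ ⟨hz, hz0, hz1⟩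
    have h0 : (0 : ℝ) ∈ Icc 0 p.ℓ := left_mem_Icc.2 p.ℓ_pos.le
    refine ⟨add_mem hy hz, ?_, ?_⟩
    · rw [contRep_add p.ℓ_pos hy hz h0, hy0, hz0, add_zero]
    · rw [wderiv_add hy hz, contRep_add p.ℓ_pos (wderiv_mem hy) (wderiv_mem hz) h0, hy1, hz1,
        add_zero]
  zero_mem' := by
    have h0 : (0 : ℝ) ∈ Icc 0 p.ℓ := left_mem_Icc.2 p.ℓ_pos.le
    exact ⟨zero_mem _, contRep_zero p.ℓ_pos h0, by rw [wderiv_zero, contRep_zero p.ℓ_pos h0]⟩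
  smul_mem' := by
    rintro c y ⟨hy, hy0, hy1⟩
    have h0 : (0 : ℝ) ∈ Icc 0 p.ℓ := left_mem_Icc.2 p.ℓ_pos.le
    refine ⟨Submodule.smul_mem _ c hy, ?_, ?_⟩
    · rw [contRep_smul p.ℓ_pos c hy h0, hy0, mul_zero]
    · rw [wderiv_smul c hy, contRep_smul p.ℓ_pos c (wderiv_mem hy) h0, hy1, mul_zero]

/-- The product Lebesgue measure on `(0, ℓ) × (0, 1)`. -/
abbrev lebQ (ℓ : ℝ) : Measure (ℝ × ℝ) := (leb 0 ℓ).prod (leb 0 1)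

/-- `L²((0, ℓ) × (0, 1))`. -/
abbrev L2Q (ℓ : ℝ) : Type := Lp ℝ 2 (lebQ ℓ)

/-- The state space `ℋ = H²_E(0, ℓ) × L²(0, ℓ) × L²((0, ℓ) × (0, 1))`, as a vector space. -/
def State (p : Params) : Type := H2E p × L2 0 p.ℓ × L2Q p.ℓ

instance (p : Params) : AddCommGroup (State p) :=
  inferInstanceAs (AddCommGroup (H2E p × L2 0 p.ℓ × L2Q p.ℓ))

instance (p : Params) : Module ℝ (State p) :=
  inferInstanceAs (Module ℝ (H2E p × L2 0 p.ℓ × L2Q p.ℓ))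

namespace State

variable {p : Params}

/-- The displacement component `y`. -/
def y (Y : State p) : L2 0 p.ℓ := (Prod.fst Y : H2E p)

/-- The velocity component `v`. -/
def v (Y : State p) : L2 0 p.ℓ := Prod.fst (Prod.snd Y)

/-- The delay component `u`. -/
def u (Y : State p) : L2Q p.ℓ := Prod.snd (Prod.snd Y)

/-- The state with components `y ∈ H²_E`, `v`, `u`. -/
def mk (y : H2E p) (v : L2 0 p.ℓ) (u : L2Q p.ℓ) : State p := (y, v, u)

theorem y_mem (Y : State p) : Y.y ∈ H2E p := (Prod.fst Y : H2E p).2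

theorem ext {Y Z : State p} (hy : Y.y = Z.y) (hv : Y.v = Z.v) (hu : Y.u = Z.u) : Y = Z :=
  Prod.ext (Subtype.ext hy) (Prod.ext hv hu)

@[simp] theorem y_mk (y : H2E p) (v : L2 0 p.ℓ) (u : L2Q p.ℓ) : (mk y v u).y = y := rfl
@[simp] theorem v_mk (y : H2E p) (v : L2 0 p.ℓ) (u : L2Q p.ℓ) : (mk y v u).v = v := rfl
@[simp] theorem u_mk (y : H2E p) (v : L2 0 p.ℓ) (u : L2Q p.ℓ) : (mk y v u).u = u := rfl
@[simp] theorem y_add (Y Z : State p) : (Y + Z).y = Y.y + Z.y := rfl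
@[simp] theorem v_add (Y Z : State p) : (Y + Z).v = Y.v + Z.v := rfl
@[simp] theorem u_add (Y Z : State p) : (Y + Z).u = Y.u + Z.u := rfl
@[simp] theorem y_smul (c : ℝ) (Y : State p) : (c • Y).y = c • Y.y := rfl
@[simp] theorem v_smul (c : ℝ) (Y : State p) : (c • Y).v = c • Y.v := rfl
@[simp] theorem u_smul (c : ℝ) (Y : State p) : (c • Y).u = c • Y.u := rfl
@[simp] theorem y_zero : (0 : State p).y = 0 := rfl
@[simp] theorem v_zero : (0 : State p).v = 0 := rfl
@[simp] theorem u_zero : (0 : State p).u = 0 := rfl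

end State

/-- The inner product
`∫ v₁ v₂ + T ∫ y₁' y₂' + ∫ y₁'' y₂'' + ξ ∫∫ u₁ u₂` on the state space, each term being written
through the inner product `∫ f g` of the respective `L²` space. -/
@[reducible] def innerCore (p : Params) : InnerProductSpace.Core ℝ (State p) where
  inner Y Z := inner ℝ Y.v Z.v + p.T * inner ℝ (wderiv Y.y) (wderiv Z.y)
    + inner ℝ (wderiv (wderiv Y.y)) (wderiv (wderiv Z.y)) + p.ξ * inner ℝ Y.u Z.u
  conj_inner_symm Y Z := by
    simp only [conj_trivial]
    rw [real_inner_comm, real_inner_comm (wderiv Y.y), real_inner_comm (wderiv (wderiv Y.y)),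
      real_inner_comm Y.u]
  re_inner_nonneg Y := by
    have := p.T_pos
    have := p.ξ_pos
    simp only [RCLike.re_to_real, real_inner_self_eq_norm_sq]
    positivity
  add_left X Y Z := by
    have hX := X.y_mem.1
    have hY := Y.y_mem.1
    simp only [State.y_add, State.v_add, State.u_add, wderiv_add hX hY,
      wderiv_add (wderiv_mem hX) (wderiv_mem hY), inner_add_left]
    ring
  smul_left X Y r := by
    have hX := X.y_mem.1
    simp only [State.y_smul, State.v_smul, State.u_smul, wderiv_smul r hX,
      wderiv_smul r (wderiv_mem hX), real_inner_smul_left, conj_trivial]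
    ring
  definite Y h := by
    have hT := p.T_pos
    have hξ := p.ξ_pos
    simp only [real_inner_self_eq_norm_sq] at h
    have e1 := sq_nonneg ‖Y.v‖
    have e2 := mul_nonneg hT.le (sq_nonneg ‖wderiv Y.y‖)
    have e3 := sq_nonneg ‖wderiv (wderiv Y.y)‖
    have e4 := mul_nonneg hξ.le (sq_nonneg ‖Y.u‖)
    have h1 : ‖Y.v‖ ^ 2 = 0 := by linarith
    have h2 : ‖wderiv Y.y‖ ^ 2 = 0 :=
      (mul_eq_zero.1 (by linarith : p.T * ‖wderiv Y.y‖ ^ 2 = 0)).resolve_left hT.ne'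
    have h3 : ‖Y.u‖ ^ 2 = 0 :=
      (mul_eq_zero.1 (by linarith : p.ξ * ‖Y.u‖ ^ 2 = 0)).resolve_left hξ.ne'
    rw [sq_eq_zero_iff, norm_eq_zero] at h1 h2 h3
    refine State.ext (Lp.ext ?_) h1 h3
    refine (ae_eq_primitive p.ℓ_pos Y.y_mem.1 Y.y_mem.2.1).trans ?_
    rw [h2]
    have hz : (0 : L2 0 p.ℓ) =ᵐ[leb 0 p.ℓ] 0 := Lp.coeFn_zero _ _ _
    filter_upwards [hz, ae_restrict_mem measurableSet_Ioo] with x hx hxm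
    rw [State.y_zero, hx, intervalIntegral.integral_of_le hxm.1.le]
    refine integral_eq_zero_of_ae ?_
    have : Ioc 0 x ⊆ Ioo 0 p.ℓ := fun t ht => ⟨ht.1, ht.2.trans_lt hxm.2⟩
    exact ae_mono (Measure.restrict_mono_set _ this) hz

instance (p : Params) : NormedAddCommGroup (State p) :=
  (innerCore p).toNormedAddCommGroup

instance (p : Params) : InnerProductSpace ℝ (State p) :=
  InnerProductSpace.ofCore (innerCore p).toCore

theorem State.norm_sq {p : Params} (Y : State p) :
    ‖Y‖ ^ 2 = ‖Y.v‖ ^ 2 + p.T * ‖wderiv Y.y‖ ^ 2 + ‖wderiv (wderiv Y.y)‖ ^ 2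
      + p.ξ * ‖Y.u‖ ^ 2 := by
  simp only [← real_inner_self_eq_norm_sq]
  rfl

section complete

theorem le_of_sq_le {r t : ℝ} (ht : 0 ≤ t) (h : r ^ 2 ≤ t ^ 2) : r ≤ t :=
  le_of_abs_le (abs_le_of_sq_le_sq h ht)

variable {a b : ℝ}

theorem continuousOn_primitive (hab : a < b) {f : ℝ → ℝ} (hf : Integrable f (leb a b)) :
    ContinuousOn (fun x => ∫ t in a..x, f t) (Icc a b) := by
  have hi : IntegrableOn f (uIcc a b) := by
    rw [uIcc_of_le hab.le, integrableOn_Icc_iff_integrableOn_Ioo]; exact hf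
  simpa [uIcc_of_le hab.le] using intervalIntegral.continuousOn_primitive_interval hi

theorem abs_primitive_le (f : L2 a b) {x : ℝ} (hx : x ∈ Ioo a b) :
    |∫ t in a..x, f t| ≤ √(b - a) * ‖f‖ := by
  have hs : MeasurableSet (Ioc a x) := measurableSet_Ioc
  have hsub : Ioc a x ⊆ Ioo a b := fun t ht => ⟨ht.1, ht.2.trans_lt hx.2⟩
  have hm : leb a b (Ioc a x) ≠ ⊤ := measure_ne_top _ _
  have h1 : ∫ t in a..x, f t = inner ℝ (indicatorConstLp 2 hs hm (1 : ℝ)) f := by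
    rw [L2.inner_indicatorConstLp_one, intervalIntegral.integral_of_le hx.1.le,
      Measure.restrict_restrict hs, inter_eq_left.2 hsub]
  rw [h1]
  refine (abs_real_inner_le_norm _ _).trans (mul_le_mul_of_nonneg_right ?_ (norm_nonneg _))
  rw [norm_indicatorConstLp two_ne_zero ENNReal.ofNat_ne_top, norm_one, one_mul,
    Real.sqrt_eq_rpow]
  have h2 : (leb a b).real (Ioc a x) = x - a := by
    rw [measureReal_restrict_apply hs, inter_eq_left.2 hsub, Real.volume_real_Ioc_of_le hx.1.le]
  rw [h2]
  norm_num
  exact Real.rpow_le_rpow (by linarith [hx.1]) (by linarith [hx.2]) (by norm_num)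

theorem exists_primitive (hab : a < b) (f : L2 a b) :
    ∃ g : L2 a b, HasWeakDeriv a b g f ∧ contRep a b g a = 0 := by
  have hc := continuousOn_primitive hab (L2.integrable f)
  have hmem : MemLp (fun x => ∫ t in a..x, f t) 2 (leb a b) := by
    refine MemLp.of_bound (C := √(b - a) * ‖f‖)
      ((hc.mono Ioo_subset_Icc_self).aestronglyMeasurable measurableSet_Ioo) ?_
    filter_upwards [ae_restrict_mem measurableSet_Ioo] with x hx
    exact abs_primitive_le f hx
  refine ⟨hmem.toLp, ?_, ?_⟩
  · exact (HasWeakDeriv.of_primitive hab (L2.integrable f)).congr hmem.coeFn_toLp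
      (ae_eq_refl _)
  · rw [contRep_eqOn hab (F := fun x => ∫ t in a..x, f t) ⟨hc, hmem.coeFn_toLp⟩
      (left_mem_Icc.2 hab.le)]
    exact intervalIntegral.integral_same

theorem exists_norm_le (a b : ℝ) : ∃ C : ℝ, 0 ≤ C ∧ ∀ (k : ℕ) (f : L2 a b), a < b →
    f ∈ sobolev a b (k + 1) → contRep a b f a = 0 → ‖f‖ ≤ C * ‖wderiv f‖ := by
  refine ⟨(leb a b).real univ ^ (ENNReal.toReal 2)⁻¹ * √(b - a), by positivity,
    fun k f hab hf h0 => ?_⟩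
  rw [mul_assoc]
  refine Lp.norm_le_of_ae_bound (by positivity) ?_
  filter_upwards [ae_eq_primitive hab hf h0, ae_restrict_mem measurableSet_Ioo] with x hx hxm
  rw [hx]
  exact abs_primitive_le _ hxm

end complete

/-- The state space is a Hilbert space. -/
instance (p : Params) : CompleteSpace (State p) := by
  have hT := p.T_pos
  have hξ := p.ξ_pos
  let Φl : State p →ₗ[ℝ] L2 0 p.ℓ × L2 0 p.ℓ × L2Q p.ℓ :=
    { toFun := fun Y => (wderiv (wderiv Y.y), Y.v, Y.u)
      map_add' := fun Y Z => by
        simp only [State.y_add, State.v_add, State.u_add, wderiv_add Y.y_mem.1 Z.y_mem.1,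
          wderiv_add (wderiv_mem Y.y_mem.1) (wderiv_mem Z.y_mem.1)]
        rfl
      map_smul' := fun c Y => by
        simp only [State.y_smul, State.v_smul, State.u_smul, wderiv_smul c Y.y_mem.1,
          wderiv_smul c (wderiv_mem Y.y_mem.1)]
        rfl }
  have hΦ : ∀ Y, Φl Y = (wderiv (wderiv Y.y), Y.v, Y.u) := fun _ => rfl
  obtain ⟨C, hC0, hC⟩ := exists_norm_le 0 p.ℓ
  let Φ : State p →L[ℝ] L2 0 p.ℓ × L2 0 p.ℓ × L2Q p.ℓ :=
    Φl.mkContinuous (1 + (√p.ξ)⁻¹) fun Y => by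
      have hn := Y.norm_sq
      have e2 := mul_nonneg hT.le (sq_nonneg ‖wderiv Y.y‖)
      have e4 := mul_nonneg hξ.le (sq_nonneg ‖Y.u‖)
      have hi : 0 ≤ (√p.ξ)⁻¹ := by positivity
      have hle : ‖Y‖ ≤ (1 + (√p.ξ)⁻¹) * ‖Y‖ := by
        nlinarith [mul_nonneg hi (norm_nonneg Y)]
      rw [hΦ, Prod.norm_def, Prod.norm_def]
      refine max_le ?_ (max_le ?_ ?_)
      · refine (le_of_sq_le (norm_nonneg Y) ?_).trans hle
        nlinarith [sq_nonneg ‖Y.v‖]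
      · refine (le_of_sq_le (norm_nonneg Y) ?_).trans hle
        nlinarith [sq_nonneg ‖wderiv (wderiv Y.y)‖]
      · have h1 : √p.ξ * ‖Y.u‖ ≤ ‖Y‖ := by
          refine le_of_sq_le (norm_nonneg Y) ?_
          rw [mul_pow, Real.sq_sqrt hξ.le]
          nlinarith [sq_nonneg ‖Y.v‖, sq_nonneg ‖wderiv (wderiv Y.y)‖]
        have h2 : ‖Y.u‖ = (√p.ξ)⁻¹ * (√p.ξ * ‖Y.u‖) := by
          rw [inv_mul_cancel_left₀ (Real.sqrt_pos.2 hξ).ne']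
        calc ‖Y.u‖ = (√p.ξ)⁻¹ * (√p.ξ * ‖Y.u‖) := h2
          _ ≤ (√p.ξ)⁻¹ * ‖Y‖ := mul_le_mul_of_nonneg_left h1 hi
          _ ≤ (1 + (√p.ξ)⁻¹) * ‖Y‖ := by nlinarith [norm_nonneg Y]
  have hanti : AntilipschitzWith (Real.toNNReal √(2 + p.T * C ^ 2 + p.ξ)) Φ := by
    refine Φ.antilipschitz_of_bound fun Y => ?_
    rw [Real.coe_toNNReal _ (Real.sqrt_nonneg _)]
    have hn := Y.norm_sq
    have hΦY : Φ Y = (wderiv (wderiv Y.y), Y.v, Y.u) := rfl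
    have h1 : ‖wderiv (wderiv Y.y)‖ ≤ ‖Φ Y‖ := by
      rw [hΦY]; exact norm_fst_le (wderiv (wderiv Y.y), (Y.v, Y.u))
    have h2 : ‖Y.v‖ ≤ ‖Φ Y‖ := by
      rw [hΦY]; exact (norm_fst_le (Y.v, Y.u)).trans (norm_snd_le (wderiv (wderiv Y.y), (Y.v, Y.u)))
    have h3 : ‖Y.u‖ ≤ ‖Φ Y‖ := by
      rw [hΦY]; exact (norm_snd_le (Y.v, Y.u)).trans (norm_snd_le (wderiv (wderiv Y.y), (Y.v, Y.u)))
    have h4 : ‖wderiv Y.y‖ ≤ C * ‖Φ Y‖ :=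
      (hC 0 _ p.ℓ_pos (wderiv_mem Y.y_mem.1) Y.y_mem.2.2).trans
        (mul_le_mul_of_nonneg_left h1 hC0)
    have q1 := pow_le_pow_left₀ (norm_nonneg _) h1 2
    have q2 := pow_le_pow_left₀ (norm_nonneg _) h2 2
    have q3 := mul_le_mul_of_nonneg_left (pow_le_pow_left₀ (norm_nonneg _) h3 2) hξ.le
    have q4 := mul_le_mul_of_nonneg_left (pow_le_pow_left₀ (norm_nonneg _) h4 2) hT.le
    have hpos : 0 ≤ 2 + p.T * C ^ 2 + p.ξ := by positivity
    refine le_of_sq_le (by positivity) ?_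
    rw [mul_pow, Real.sq_sqrt hpos, hn]
    nlinarith
  have hsurj : Function.Surjective Φ := by
    rintro ⟨w, v, u⟩
    have hℓ := p.ℓ_pos
    obtain ⟨z, hz, hz0⟩ := exists_primitive hℓ w
    obtain ⟨y, hy, hy0⟩ := exists_primitive hℓ z
    have hz1 : z ∈ sobolev 0 p.ℓ 1 := mem_sobolev_succ.2 ⟨w, Submodule.mem_top, hz⟩
    have hy2 : y ∈ sobolev 0 p.ℓ 2 := mem_sobolev_succ.2 ⟨z, hz1, hy⟩
    refine ⟨State.mk ⟨y, hy2, hy0, by rw [wderiv_eq hy, hz0]⟩ v u, ?_⟩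
    change (wderiv (wderiv y), v, u) = _
    rw [wderiv_eq hy, wderiv_eq hz]
  exact ((hanti.isUniformInducing Φ.uniformContinuous).completeSpace_congr hsurj).2 inferInstance

/-! ### The delay variable -/

section delay

variable {ℓ : ℝ}

/-- `w` is the weak derivative `u_s` of `u`: for almost every `x`, the function `w(x, ·)` is the
weak derivative of `u(x, ·)` on `(0, 1)`. -/
def HasWeakDerivS (u w : L2Q ℓ) : Prop :=
  ∀ᵐ x ∂(leb 0 ℓ), HasWeakDeriv 0 1 (fun s => u (x, s)) (fun s => w (x, s))

/-- The space `L²(0, ℓ; H¹(0, 1))`: those `u ∈ L²((0, ℓ) × (0, 1))` with `u(x, ·) ∈ H¹(0, 1)` for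
almost every `x` and `u_s ∈ L²((0, ℓ) × (0, 1))`. -/
def InL2H1 (u : L2Q ℓ) : Prop := ∃ w : L2Q ℓ, HasWeakDerivS u w

open Classical in
/-- The derivative `u_s` of `u ∈ L²(0, ℓ; H¹(0, 1))` (zero for other `u`). -/
def sderiv (u : L2Q ℓ) : L2Q ℓ := if h : InL2H1 u then h.choose else 0

/-- The value `u(x, s)` for `s ∈ [0, 1]`, computed on the continuous representative of
`u(x, ·)`. -/
def fibreVal (u : L2Q ℓ) (s : ℝ) (x : ℝ) : ℝ := contRep 0 1 (fun r => u (x, r)) s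

open Classical in
/-- The trace `u(·, 1)`, as an element of `L²(0, ℓ)` (zero if it is not square integrable, which
does not happen for `u ∈ L²(0, ℓ; H¹(0, 1))`). -/
def traceOne (u : L2Q ℓ) : L2 0 ℓ :=
  if h : MemLp (fibreVal u 1) 2 (leb 0 ℓ) then h.toLp else 0

theorem ae_fibre_add (u u₁ : L2Q ℓ) : ∀ᵐ x ∂(leb 0 ℓ),
    (fun s => (u + u₁ : L2Q ℓ) (x, s)) =ᵐ[leb 0 1] fun s => u (x, s) + u₁ (x, s) :=
  Measure.ae_ae_of_ae_prod (Lp.coeFn_add u u₁)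

theorem ae_fibre_smul (c : ℝ) (u : L2Q ℓ) : ∀ᵐ x ∂(leb 0 ℓ),
    (fun s => (c • u : L2Q ℓ) (x, s)) =ᵐ[leb 0 1] fun s => c * u (x, s) :=
  Measure.ae_ae_of_ae_prod (Lp.coeFn_smul c u)

theorem ae_fibre_zero : ∀ᵐ x ∂(leb 0 ℓ),
    (fun s => (0 : L2Q ℓ) (x, s)) =ᵐ[leb 0 1] fun _ => 0 :=
  Measure.ae_ae_of_ae_prod (Lp.coeFn_zero _ _ _)

theorem HasWeakDerivS.add {u w u₁ w₁ : L2Q ℓ} (h : HasWeakDerivS u w)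
    (h₁ : HasWeakDerivS u₁ w₁) : HasWeakDerivS (u + u₁) (w + w₁) := by
  filter_upwards [h, h₁, ae_fibre_add u u₁, ae_fibre_add w w₁] with x h1 h2 h3 h4
  exact (h1.add h2).congr h3 h4

theorem HasWeakDerivS.smul {u w : L2Q ℓ} (c : ℝ) (h : HasWeakDerivS u w) :
    HasWeakDerivS (c • u) (c • w) := by
  filter_upwards [h, ae_fibre_smul c u, ae_fibre_smul c w] with x h1 h3 h4
  exact (h1.smul c).congr h3 h4

theorem HasWeakDerivS.zero : HasWeakDerivS (0 : L2Q ℓ) 0 := by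
  filter_upwards [ae_fibre_zero (ℓ := ℓ)] with x h
  exact HasWeakDeriv.zero.congr h h

theorem HasWeakDerivS.unique {u w w₁ : L2Q ℓ} (h : HasWeakDerivS u w)
    (h₁ : HasWeakDerivS u w₁) : w = w₁ := by
  refine Lp.ext ((Measure.ae_prod_iff_ae_ae ?_).2 ?_)
  · exact measurableSet_eq_fun (Lp.stronglyMeasurable w).measurable
      (Lp.stronglyMeasurable w₁).measurable
  · filter_upwards [h, h₁] with x h1 h2
    exact h1.unique h2

theorem sderiv_eq {u w : L2Q ℓ} (h : HasWeakDerivS u w) : sderiv u = w := by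
  have hex : InL2H1 u := ⟨w, h⟩
  have h1 : sderiv u = hex.choose := dif_pos hex
  rw [h1]
  exact hex.choose_spec.unique h

theorem InL2H1.hasWeakDerivS {u : L2Q ℓ} (h : InL2H1 u) : HasWeakDerivS u (sderiv u) := by
  obtain ⟨w, hw⟩ := h
  rwa [sderiv_eq hw]

theorem fibreVal_add {u u₁ : L2Q ℓ} (h : InL2H1 u) (h₁ : InL2H1 u₁) {s : ℝ}
    (hs : s ∈ Icc (0 : ℝ) 1) :
    fibreVal (u + u₁) s =ᵐ[leb 0 ℓ] fun x => fibreVal u s x + fibreVal u₁ s x := by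
  filter_upwards [h.hasWeakDerivS, h₁.hasWeakDerivS, ae_fibre_add u u₁] with x h1 h2 h3
  obtain ⟨F, hF, -⟩ := h1.exists_contRep one_pos
  obtain ⟨F₁, hF₁, -⟩ := h2.exists_contRep one_pos
  simp only [fibreVal]
  rw [contRep_eqOn one_pos hF hs, contRep_eqOn one_pos hF₁ hs,
    contRep_eqOn one_pos ((hF.add hF₁).congr h3) hs]

theorem fibreVal_smul {u : L2Q ℓ} (c : ℝ) (h : InL2H1 u) {s : ℝ} (hs : s ∈ Icc (0 : ℝ) 1) :
    fibreVal (c • u) s =ᵐ[leb 0 ℓ] fun x => c * fibreVal u s x := by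
  filter_upwards [h.hasWeakDerivS, ae_fibre_smul c u] with x h1 h3
  obtain ⟨F, hF, -⟩ := h1.exists_contRep one_pos
  simp only [fibreVal]
  rw [contRep_eqOn one_pos hF hs, contRep_eqOn one_pos ((hF.smul c).congr h3) hs]

theorem fibreVal_zero {s : ℝ} (hs : s ∈ Icc (0 : ℝ) 1) :
    fibreVal (0 : L2Q ℓ) s =ᵐ[leb 0 ℓ] fun _ => 0 := by
  filter_upwards [ae_fibre_zero (ℓ := ℓ)] with x h
  exact contRep_eqOn one_pos (F := fun _ => 0) ⟨continuousOn_const, h⟩ hs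

theorem HasWeakDeriv.contRep_one {f g : ℝ → ℝ} (h : HasWeakDeriv 0 1 f g) :
    contRep 0 1 f 1 = ∫ s in Ioo 0 1, (f s + s * g s) := by
  obtain ⟨F, hF, hF'⟩ := h.exists_contRep one_pos
  have hi : IntervalIntegrable g volume 0 1 := by
    rw [intervalIntegrable_iff_integrableOn_Ioo_of_le zero_le_one]; exact h.2.1
  have hac : AbsolutelyContinuousOnInterval (fun x => ∫ t in (0 : ℝ)..x, g t) 0 1 :=
    hi.absolutelyContinuousOnInterval_intervalIntegral left_mem_uIcc
  have hid : AbsolutelyContinuousOnInterval (fun x : ℝ => x) 0 1 :=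
    contDiffOn_id.absolutelyContinuousOnInterval
  have key := hid.integral_mul_deriv_eq_deriv_mul hac
  have e1 : ∫ x in (0 : ℝ)..1, x * deriv (fun x => ∫ t in (0 : ℝ)..x, g t) x
      = ∫ x in Ioo (0 : ℝ) 1, x * g x := by
    rw [intervalIntegral.integral_of_le zero_le_one, integral_Ioc_eq_integral_Ioo]
    refine setIntegral_congr_ae measurableSet_Ioo ?_
    filter_upwards [hi.ae_hasDerivAt_integral] with x hx hxm
    rw [(hx (by rw [uIcc_of_le zero_le_one]; exact Ioo_subset_Icc_self hxm) 0
      left_mem_uIcc).deriv]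
  have e2 : ∫ x in Ioo (0 : ℝ) 1, f x
      = F 0 + ∫ x in (0 : ℝ)..1, ∫ t in (0 : ℝ)..x, g t := by
    rw [integral_congr_ae hF.2, ← integral_Ioc_eq_integral_Ioo,
      ← intervalIntegral.integral_of_le zero_le_one, intervalIntegral.integral_congr
        (g := fun x => F 0 + ∫ t in (0 : ℝ)..x, g t) (fun x _ => hF' x),
      intervalIntegral.integral_add intervalIntegrable_const hac.continuousOn.intervalIntegrable]
    simp
  have hgi : Integrable (fun s : ℝ => s * g s) (leb 0 1) := by
    refine h.2.1.bdd_mul (c := 1) (f := fun s : ℝ => s)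
      continuous_id.aestronglyMeasurable ?_
    filter_upwards [ae_restrict_mem measurableSet_Ioo] with x hx
    rw [Real.norm_eq_abs, abs_of_pos hx.1]; exact hx.2.le
  rw [integral_add h.1 hgi, contRep_eqOn one_pos hF (right_mem_Icc.2 zero_le_one), hF' 1, e2, ← e1,
    key]
  simp

theorem memLp_fibreVal_one {u : L2Q ℓ} (h : InL2H1 u) :
    MemLp (fibreVal u 1) 2 (leb 0 ℓ) := by
  set w := sderiv u
  have hw := h.hasWeakDerivS
  have hbd : ∀ᵐ z : ℝ × ℝ ∂(lebQ ℓ), ‖z.2‖ ≤ 1 := by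
    refine (Measure.ae_prod_iff_ae_ae (measurableSet_le (by fun_prop) (by fun_prop))).2
      (Eventually.of_forall fun x => ?_)
    filter_upwards [ae_restrict_mem measurableSet_Ioo] with s hs
    rw [Real.norm_eq_abs, abs_of_pos hs.1]; exact hs.2.le
  have hsw : MemLp (fun z : ℝ × ℝ => z.2 * w z) 2 (lebQ ℓ) := by
    refine (Lp.memLp w).of_le (measurable_snd.aestronglyMeasurable.mul
      (Lp.aestronglyMeasurable w)) ?_
    filter_upwards [hbd] with z hz
    rw [norm_mul]
    exact mul_le_of_le_one_left (norm_nonneg _) hz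
  have hk : MemLp (fun z : ℝ × ℝ => u z + z.2 * w z) 2 (lebQ ℓ) := (Lp.memLp u).add hsw
  set k : ℝ × ℝ → ℝ := fun z => u z + z.2 * w z with hkdef
  have hval : fibreVal u 1 =ᵐ[leb 0 ℓ] fun x => ∫ s in Ioo (0 : ℝ) 1, k (x, s) := by
    filter_upwards [hw] with x hx
    exact hx.contRep_one
  refine (memLp_congr_ae hval).2 ?_
  have hmeas : AEStronglyMeasurable (fun x => ∫ s in Ioo (0 : ℝ) 1, k (x, s)) (leb 0 ℓ) :=
    hk.1.integral_prod_right'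
  rw [memLp_two_iff_integrable_sq hmeas]
  have hk2 : Integrable (fun z => k z ^ 2) (lebQ ℓ) := hk.integrable_sq
  have hk1 : Integrable k (lebQ ℓ) := hk.integrable one_le_two
  refine hk2.integral_prod_left.mono' (hmeas.pow 2) ?_
  filter_upwards [hk1.prod_right_ae, hk2.prod_right_ae] with x hx1 hx2
  rw [Real.norm_eq_abs, abs_of_nonneg (sq_nonneg _)]
  set m := ∫ s in Ioo (0 : ℝ) 1, k (x, s) with hm
  have hnn : 0 ≤ ∫ s in Ioo (0 : ℝ) 1, (k (x, s) - m) ^ 2 := integral_nonneg fun _ => sq_nonneg _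
  have hexp : ∫ s in Ioo (0 : ℝ) 1, (k (x, s) - m) ^ 2
      = (∫ s in Ioo (0 : ℝ) 1, k (x, s) ^ 2) - m ^ 2 := by
    have : ∀ s, (k (x, s) - m) ^ 2 = k (x, s) ^ 2 - 2 * m * k (x, s) + m ^ 2 := fun s => by ring
    simp only [this]
    have hx3 : Integrable (fun s => k (x, s) ^ 2 - 2 * m * k (x, s)) (leb 0 1) :=
      hx2.sub (hx1.const_mul _)
    rw [integral_add hx3 (integrable_const _),
      integral_sub hx2 (hx1.const_mul _), integral_const_mul, ← hm]
    simp
    ring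
  linarith

theorem traceOne_ae {u : L2Q ℓ} (h : InL2H1 u) : traceOne u =ᵐ[leb 0 ℓ] fibreVal u 1 := by
  have hm := memLp_fibreVal_one h
  have h1 : traceOne u = hm.toLp := dif_pos hm
  rw [h1]
  exact hm.coeFn_toLp

theorem InL2H1.add {u u₁ : L2Q ℓ} (h : InL2H1 u) (h₁ : InL2H1 u₁) : InL2H1 (u + u₁) :=
  ⟨_, h.hasWeakDerivS.add h₁.hasWeakDerivS⟩

theorem InL2H1.smul {u : L2Q ℓ} (c : ℝ) (h : InL2H1 u) : InL2H1 (c • u) :=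
  ⟨_, h.hasWeakDerivS.smul c⟩

theorem traceOne_add {u u₁ : L2Q ℓ} (h : InL2H1 u) (h₁ : InL2H1 u₁) :
    traceOne (u + u₁) = traceOne u + traceOne u₁ := by
  refine Lp.ext ?_
  filter_upwards [traceOne_ae h, traceOne_ae h₁, traceOne_ae (h.add h₁),
    fibreVal_add h h₁ (right_mem_Icc.2 zero_le_one), Lp.coeFn_add (traceOne u) (traceOne u₁)]
    with x h1 h2 h3 h4 h5
  rw [h3, h4, h5, Pi.add_apply, h1, h2]

theorem traceOne_smul {u : L2Q ℓ} (c : ℝ) (h : InL2H1 u) :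
    traceOne (c • u) = c • traceOne u := by
  refine Lp.ext ?_
  filter_upwards [traceOne_ae h, traceOne_ae (h.smul c),
    fibreVal_smul c h (right_mem_Icc.2 zero_le_one), Lp.coeFn_smul c (traceOne u)]
    with x h1 h3 h4 h5
  rw [h3, h4, h5, Pi.smul_apply, h1, smul_eq_mul]

end delay

/-! ### The operator -/

/-- The domain `𝒟(𝔸)`: all `(y, v, u) ∈ ℋ` with `y ∈ H⁴(0, ℓ)`, `v ∈ H²_E(0, ℓ)`,
`u ∈ L²(0, ℓ; H¹(0, 1))`, `v = u(·, 0)`, `y''(ℓ) = 0` and `y'''(ℓ) - T y'(ℓ) = κ v(ℓ)`. -/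
def domainA (p : Params) : Submodule ℝ (State p) where
  carrier := {Y |
    Y.y ∈ sobolev 0 p.ℓ 4 ∧
    Y.v ∈ H2E p ∧
    InL2H1 Y.u ∧
    Y.v =ᵐ[leb 0 p.ℓ] fibreVal Y.u 0 ∧
    contRep 0 p.ℓ (wderiv (wderiv Y.y)) p.ℓ = 0 ∧
    contRep 0 p.ℓ (wderiv (wderiv (wderiv Y.y))) p.ℓ - p.T * contRep 0 p.ℓ (wderiv Y.y) p.ℓ
      = p.κ * contRep 0 p.ℓ Y.v p.ℓ}
  add_mem' := by
    rintro Y Z ⟨hy, hv, hu, hvu, h2, h3⟩ ⟨ky, kv, ku, kvu, k2, k3⟩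
    have hl : p.ℓ ∈ Icc 0 p.ℓ := right_mem_Icc.2 p.ℓ_pos.le
    have hy1 := wderiv_mem hy
    have hy2 := wderiv_mem hy1
    have hy3 := wderiv_mem hy2
    have ky1 := wderiv_mem ky
    have ky2 := wderiv_mem ky1
    have ky3 := wderiv_mem ky2
    simp only [mem_ofPred_eq, State.y_add, State.v_add, State.u_add, wderiv_add hy ky,
      wderiv_add hy1 ky1, wderiv_add hy2 ky2, contRep_add p.ℓ_pos hy1 ky1 hl,
      contRep_add p.ℓ_pos hy2 ky2 hl, contRep_add p.ℓ_pos hy3 ky3 hl,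
      contRep_add p.ℓ_pos hv.1 kv.1 hl]
    refine ⟨add_mem hy ky, add_mem hv kv, hu.add ku, ?_, by rw [h2, k2, add_zero], by linarith⟩
    filter_upwards [hvu, kvu, Lp.coeFn_add Y.v Z.v,
      fibreVal_add hu ku (left_mem_Icc.2 zero_le_one)] with x h1 h2 h3 h4
    rw [h3, h4, Pi.add_apply, h1, h2]
  zero_mem' := by
    have hl : p.ℓ ∈ Icc 0 p.ℓ := right_mem_Icc.2 p.ℓ_pos.le
    simp only [mem_ofPred_eq, State.y_zero, State.v_zero, State.u_zero, wderiv_zero,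
      contRep_zero p.ℓ_pos hl]
    refine ⟨zero_mem _, zero_mem _, ⟨0, HasWeakDerivS.zero⟩, ?_, trivial, by simp⟩
    exact (Lp.coeFn_zero _ _ _).trans (fibreVal_zero (left_mem_Icc.2 zero_le_one)).symm
  smul_mem' := by
    rintro c Y ⟨hy, hv, hu, hvu, h2, h3⟩
    have hl : p.ℓ ∈ Icc 0 p.ℓ := right_mem_Icc.2 p.ℓ_pos.le
    have hy1 := wderiv_mem hy
    have hy2 := wderiv_mem hy1
    have hy3 := wderiv_mem hy2
    simp only [mem_ofPred_eq, State.y_smul, State.v_smul, State.u_smul, wderiv_smul c hy,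
      wderiv_smul c hy1, wderiv_smul c hy2, contRep_smul p.ℓ_pos c hy1 hl,
      contRep_smul p.ℓ_pos c hy2 hl, contRep_smul p.ℓ_pos c hy3 hl,
      contRep_smul p.ℓ_pos c hv.1 hl]
    refine ⟨Submodule.smul_mem _ c hy, Submodule.smul_mem _ c hv, hu.smul c, ?_,
      by rw [h2, mul_zero], by linear_combination c * h3⟩
    filter_upwards [hvu, Lp.coeFn_smul c Y.v,
      fibreVal_smul c hu (left_mem_Icc.2 zero_le_one)] with x h1 h3 h4
    rw [h3, h4, Pi.smul_apply, h1, smul_eq_mul]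

/-- The second component `-y'''' + T y'' - α u(·, 1)` of `𝔸 (y, v, u)`. -/
def opV (p : Params) (y : L2 0 p.ℓ) (u : L2Q p.ℓ) : L2 0 p.ℓ :=
  -wderiv (wderiv (wderiv (wderiv y))) + p.T • wderiv (wderiv y) - p.α • traceOne u

/-- The third component `-τ⁻¹ u_s` of `𝔸 (y, v, u)`. -/
def opU (p : Params) (u : L2Q p.ℓ) : L2Q p.ℓ := -(p.τ⁻¹ • sderiv u)

theorem opV_add {p : Params} {y z : L2 0 p.ℓ} {u w : L2Q p.ℓ} (hy : y ∈ sobolev 0 p.ℓ 4)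
    (hz : z ∈ sobolev 0 p.ℓ 4) (hu : InL2H1 u) (hw : InL2H1 w) :
    opV p (y + z) (u + w) = opV p y u + opV p z w := by
  have hy1 := wderiv_mem hy
  have hy2 := wderiv_mem hy1
  have hy3 := wderiv_mem hy2
  have hz1 := wderiv_mem hz
  have hz2 := wderiv_mem hz1
  have hz3 := wderiv_mem hz2
  simp only [opV]
  rw [wderiv_add hy hz, wderiv_add hy1 hz1, wderiv_add hy2 hz2, wderiv_add hy3 hz3,
    traceOne_add hu hw, smul_add, smul_add]
  abel

theorem opV_smul {p : Params} (c : ℝ) {y : L2 0 p.ℓ} {u : L2Q p.ℓ} (hy : y ∈ sobolev 0 p.ℓ 4)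
    (hu : InL2H1 u) : opV p (c • y) (c • u) = c • opV p y u := by
  have hy1 := wderiv_mem hy
  have hy2 := wderiv_mem hy1
  have hy3 := wderiv_mem hy2
  simp only [opV]
  rw [wderiv_smul c hy, wderiv_smul c hy1, wderiv_smul c hy2, wderiv_smul c hy3,
    traceOne_smul c hu, smul_sub, smul_add, smul_neg, smul_comm p.T c, smul_comm p.α c]

theorem opU_add {p : Params} {u w : L2Q p.ℓ} (hu : InL2H1 u) (hw : InL2H1 w) :
    opU p (u + w) = opU p u + opU p w := by
  simp only [opU]
  rw [sderiv_eq (hu.hasWeakDerivS.add hw.hasWeakDerivS), smul_add, neg_add]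

theorem opU_smul {p : Params} (c : ℝ) {u : L2Q p.ℓ} (hu : InL2H1 u) :
    opU p (c • u) = c • opU p u := by
  simp only [opU]
  rw [sderiv_eq (hu.hasWeakDerivS.smul c), smul_neg, smul_comm p.τ⁻¹ c]

/-- The operator
`𝔸 (y, v, u) = (v, -y'''' + T y'' - α u(·, 1), -τ⁻¹ u_s)` with domain `𝒟(𝔸)`. -/
def opA (p : Params) : State p →ₗ.[ℝ] State p where
  domain := domainA p
  toFun :=
    { toFun := fun Y => State.mk ⟨Y.1.v, Y.2.2.1⟩ (opV p Y.1.y Y.1.u) (opU p Y.1.u)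
      map_add' := fun Y Z => State.ext (State.v_add Y.1 Z.1)
        (opV_add Y.2.1 Z.2.1 Y.2.2.2.1 Z.2.2.2.1) (opU_add Y.2.2.2.1 Z.2.2.2.1)
      map_smul' := fun c Y => by
        rw [RingHom.id_apply]
        refine State.ext ?_ ?_ ?_
        · rw [State.y_smul, State.y_mk, State.y_mk]
          exact State.v_smul c Y.1
        · rw [State.v_smul, State.v_mk, State.v_mk]
          exact opV_smul c Y.2.1 Y.2.2.2.1
        · rw [State.u_smul, State.u_mk, State.u_mk]
          exact opU_smul c Y.2.2.2.1 }

/-! ### Semigroups and the abstract Cauchy problem -/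

section semigroup

variable {X : Type*} [NormedAddCommGroup X] [NormedSpace ℝ X]

/-- A strongly continuous semigroup of bounded operators on `X`. -/
structure C0Semigroup (X : Type*) [NormedAddCommGroup X] [NormedSpace ℝ X] where
  op : ℝ≥0 → X →L[ℝ] X
  op_zero : op 0 = ContinuousLinearMap.id ℝ X
  op_add : ∀ s t, op (s + t) = (op s).comp (op t)
  tendsto_zero : ∀ x, Tendsto (fun t => op t x) (𝓝 0) (𝓝 x)

/-- `A` is the infinitesimal generator of `S`: `x ∈ 𝒟(A)` and `A x = z` hold if and only if
`(S(t) x - x) / t → z` as `t → 0+`. -/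
def IsGenerator (A : X →ₗ.[ℝ] X) (S : C0Semigroup X) : Prop :=
  ∀ x z : X, (∃ hx : x ∈ A.domain, A ⟨x, hx⟩ = z) ↔
    Tendsto (fun t : ℝ≥0 => (t : ℝ)⁻¹ • (S.op t x - x)) (𝓝[>] 0) (𝓝 z)

/-- `Y` is a mild solution on `[0, ∞)` of `Y' = A Y`, `Y(0) = Y₀`: it is continuous and, for every
`t ≥ 0`, `∫₀ᵗ Y(s) ds ∈ 𝒟(A)` and `Y(t) = Y₀ + A ∫₀ᵗ Y(s) ds`. -/
def IsMildSolution (A : X →ₗ.[ℝ] X) (Y₀ : X) (Y : ℝ → X) : Prop :=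
  ContinuousOn Y (Ici 0) ∧
    ∀ t : ℝ, 0 ≤ t → ∃ h : (∫ s in (0 : ℝ)..t, Y s) ∈ A.domain, Y t = Y₀ + A ⟨_, h⟩

/-- `Y` is a classical solution on `[0, ∞)` of `Y' = A Y`, `Y(0) = Y₀`, lying in
`C([0, ∞), 𝒟(A)) ∩ C¹([0, ∞), X)`: it is continuously differentiable (one-sidedly at `0`), takes
values in `𝒟(A)`, is continuous for the graph norm of `𝒟(A)`, and satisfies the equation for every
`t ≥ 0`. -/
def IsClassicalSolution (A : X →ₗ.[ℝ] X) (Y₀ : X) (Y : ℝ → X) : Prop :=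
  Y 0 = Y₀ ∧ ContDiffOn ℝ 1 Y (Ici 0) ∧
    ∃ h : ∀ t : Ici (0 : ℝ), Y t ∈ A.domain,
      Continuous (fun t : Ici (0 : ℝ) => (Y t, A ⟨Y t, h t⟩)) ∧
      ∀ t : Ici (0 : ℝ), HasDerivWithinAt Y (A ⟨Y t, h t⟩) (Ici 0) t

end semigroup
end Beam
end

/-!
The operator `𝔸` is quasi-m-dissipative: `𝔸 - γ` is dissipative for some `γ`, and `r - 𝔸` is onto
for all large `r`. The theorem is then the Hilbert space case of the Hille–Yosida theorem.

*Dissipativity* (`inner_opA_le`). Integrating by parts twice in `x`, the boundary conditions leave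
only `-κ v(ℓ)²`. The transport part contributes `-ξ / (2τ) (∫ u(·, 1)² - ∫ v²)`, whose first term
absorbs the delay term `-α ∫ u(·, 1) v` by Young's inequality; what remains is a multiple of
`∫ v²`. The weight `ξ > 0` is arbitrary since `γ` may be as large as needed.

*Range* (`exists_resolvent_opA`). In `(r - 𝔸) (y, v, u) = (f, g, h)` one has `v = r y - f`, and
Duhamel's formula gives `u` with `u(·, 1) = e^{-rτ} v + z` for a known `z` (`exists_transport`).
What is left is a fourth-order boundary value problem for `y` with zeroth-order coefficient
`r² + α r e^{-rτ} ≥ 0` (`exists_stationary`). It is solved for `w = y''`: with the primitive `V`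
from `0`, one has `y' = V w` and `y = V² w`, and the weak form of the problem is a coercive equation
in `L²` to which Lax–Milgram applies. Its solution is explicitly a primitive from `ℓ` of a
primitive, so that `y ∈ H⁴` and the natural boundary conditions at `ℓ` can be read off.

*Generation* (`IsQuasiMDissipative.wellPosed`). The domain is dense by reflexivity. The
exponentials of the Yosida approximations are uniformly bounded on compact time intervals and
converge, first on the domain and then everywhere, to a semigroup `S` with
`S(t) x - x = ∫₀ᵗ S(s) A x ds` on the domain. The generator cannot be a proper extension of `A`,
since `r - A` is onto and `r` is not an eigenvalue of the generator. Uniqueness of mild solutions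
follows from the energy estimate for the primitive of a difference of two of them.
-/

namespace Beam

/-! ### Quasi-m-dissipative operators and their Yosida approximations -/

section generation

variable {X : Type*} [NormedAddCommGroup X] [InnerProductSpace ℝ X]

/-- The operator `A - γ` is dissipative, and `r - A` is onto for every `r > γ`. -/
structure IsQuasiMDissipative (A : X →ₗ.[ℝ] X) (γ : ℝ) : Prop where
  inner_le : ∀ x : A.domain, inner ℝ (A x) (x : X) ≤ γ * ‖(x : X)‖ ^ 2
  range : ∀ r, γ < r → ∀ f : X, ∃ x : A.domain, r • (x : X) - A x = f

namespace IsQuasiMDissipative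

variable {A : X →ₗ.[ℝ] X} {γ : ℝ}

theorem norm_le (hA : IsQuasiMDissipative A γ) (r : ℝ) (x : A.domain) :
    (r - γ) * ‖(x : X)‖ ≤ ‖r • (x : X) - A x‖ := by
  rcases (norm_nonneg (x : X)).eq_or_lt with h | h
  · rw [← h, mul_zero]; exact norm_nonneg _
  · refine le_of_mul_le_mul_right ?_ h
    refine le_trans ?_ (real_inner_le_norm _ _)
    rw [inner_sub_left, real_inner_smul_left, real_inner_self_eq_norm_sq]
    linarith [hA.inner_le x]

theorem exists_resolvent (hA : IsQuasiMDissipative A γ) {r : ℝ} (hr : γ < r) :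
    ∃ R : X →L[ℝ] X, (∀ f, ∃ h : R f ∈ A.domain, r • R f - A ⟨R f, h⟩ = f) ∧
      (∀ x : A.domain, R (r • (x : X) - A x) = x) ∧ ∀ f, ‖R f‖ ≤ (r - γ)⁻¹ * ‖f‖ := by
  have hpos : 0 < r - γ := sub_pos.2 hr
  choose g hg using hA.range r hr
  have inj : ∀ x y : A.domain, r • (x : X) - A x = r • (y : X) - A y → x = y := by
    intro x y h
    have h1 := hA.norm_le r (x - y)
    have h2 : r • ((x - y : A.domain) : X) - A (x - y) = 0 := by
      rw [A.map_sub, Submodule.coe_sub, smul_sub, ← sub_eq_zero.2 h]; abel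
    rw [h2, norm_zero] at h1
    have h3 : ‖((x - y : A.domain) : X)‖ ≤ 0 := by
      by_contra hc
      nlinarith [mul_pos hpos (not_le.1 hc)]
    have h4 : ((x - y : A.domain) : X) = 0 := norm_le_zero_iff.1 h3
    exact sub_eq_zero.1 (Subtype.ext h4)
  let R : X →ₗ[ℝ] X :=
    { toFun := fun f => g f
      map_add' := fun f f' => by
        rw [← Submodule.coe_add]
        refine congrArg Subtype.val (inj _ _ ?_)
        rw [hg, A.map_add, Submodule.coe_add, smul_add, add_sub_add_comm, hg, hg]
      map_smul' := fun c f => by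
        rw [RingHom.id_apply, ← Submodule.coe_smul]
        refine congrArg Subtype.val (inj _ _ ?_)
        rw [hg, A.map_smul, Submodule.coe_smul, smul_comm, ← smul_sub, hg] }
  refine ⟨R.mkContinuous (r - γ)⁻¹ fun f => ?_, fun f => ⟨(g f).2, hg f⟩, fun x => ?_,
    fun f => ?_⟩
  · rw [← div_eq_inv_mul, le_div_iff₀' hpos]
    have := hA.norm_le r (g f)
    rwa [hg] at this
  · exact congrArg Subtype.val (inj _ _ (hg _))
  · rw [← div_eq_inv_mul, le_div_iff₀' hpos]
    have := hA.norm_le r (g f)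
    rwa [hg] at this

/-- Reflexivity makes density automatic: if `x ⊥ 𝒟(A)` and `x = (r - A) y`, then `⟪x, y⟫ = 0`
forces `y = 0`. -/
theorem dense_domain [CompleteSpace X] (hA : IsQuasiMDissipative A γ) :
    Dense (A.domain : Set X) := by
  rw [Submodule.dense_iff_topologicalClosure_eq_top, Submodule.topologicalClosure_eq_top_iff,
    Submodule.eq_bot_iff]
  intro x hx
  obtain ⟨y, hy⟩ := hA.range (γ + 1) (by linarith) x
  have h0 : inner ℝ (y : X) x = 0 := (Submodule.mem_orthogonal _ _).1 hx y y.2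
  rw [real_inner_comm, ← hy, inner_sub_left, real_inner_smul_left, real_inner_self_eq_norm_sq]
    at h0
  have h1 : ‖(y : X)‖ ^ 2 = 0 := by nlinarith [hA.inner_le y, sq_nonneg ‖(y : X)‖]
  have h2 : y = 0 := Subtype.ext (norm_eq_zero.1 (pow_eq_zero_iff two_ne_zero |>.1 h1))
  rw [← hy, h2]
  simp

end IsQuasiMDissipative

/-- Pointwise convergence of equibounded operators only has to be checked on a dense set. -/
theorem tendsto_of_dense {ι : Type*} {l : Filter ι} {L : ι → X →L[ℝ] X} {S : X →L[ℝ] X} {C : ℝ}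
    (hC : ∀ᶠ i in l, ∀ x, ‖L i x‖ ≤ C * ‖x‖) {D : Set X} (hD : Dense D)
    (h : ∀ x ∈ D, Tendsto (fun i => L i x) l (𝓝 (S x))) (x : X) :
    Tendsto (fun i => L i x) l (𝓝 (S x)) := by
  rw [Metric.tendsto_nhds]
  intro ε hε
  obtain ⟨M, hM0, hCM, hSM⟩ : ∃ M : ℝ, 0 < M ∧ C ≤ M ∧ ‖S‖ ≤ M :=
    ⟨|C| + ‖S‖ + 1, by positivity, by linarith [le_abs_self C, norm_nonneg S],
      by linarith [abs_nonneg C]⟩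
  obtain ⟨y, hyD, hy⟩ := hD.exists_dist_lt x (show 0 < ε / (3 * M) by positivity)
  have hxy : M * ‖x - y‖ < ε / 3 := by
    rw [dist_eq_norm, lt_div_iff₀ (by positivity)] at hy
    linarith
  filter_upwards [hC, Metric.tendsto_nhds.1 (h y hyD) (ε / 3) (by positivity)] with i hi hi2
  rw [dist_eq_norm] at hi2 ⊢
  have e : L i x - S x = L i (x - y) + (L i y - S y) - S (x - y) := by
    rw [map_sub, map_sub]; abel
  rw [e]
  have h1 : ‖L i (x - y)‖ ≤ M * ‖x - y‖ :=
    (hi _).trans (mul_le_mul_of_nonneg_right hCM (norm_nonneg _))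
  have h2 : ‖S (x - y)‖ ≤ M * ‖x - y‖ :=
    (S.le_opNorm _).trans (mul_le_mul_of_nonneg_right hSM (norm_nonneg _))
  have h3 := norm_sub_le (L i (x - y) + (L i y - S y)) (S (x - y))
  have h4 := norm_add_le (L i (x - y)) (L i y - S y)
  linarith

theorem exists_limit_of_dense [CompleteSpace X] {L : ℕ → X →L[ℝ] X} {C : ℝ} (hC0 : 0 ≤ C)
    (hC : ∀ n x, ‖L n x‖ ≤ C * ‖x‖) {D : Set X} (hD : Dense D)
    (h : ∀ x ∈ D, CauchySeq fun n => L n x) :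
    ∃ S : X →L[ℝ] X, ∀ x, Tendsto (fun n => L n x) atTop (𝓝 (S x)) := by
  have hcau : ∀ x, ∃ z, Tendsto (fun n => L n x) atTop (𝓝 z) := by
    refine fun x => cauchySeq_tendsto_of_complete (Metric.cauchySeq_iff.2 fun ε hε => ?_)
    obtain ⟨y, hyD, hy⟩ := hD.exists_dist_lt x (show 0 < ε / (3 * (C + 1)) by positivity)
    have hxy : C * ‖x - y‖ < ε / 3 := by
      rw [dist_eq_norm, lt_div_iff₀ (by positivity)] at hy
      nlinarith [norm_nonneg (x - y)]
    obtain ⟨N, hN⟩ := Metric.cauchySeq_iff.1 (h y hyD) (ε / 3) (by positivity)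
    refine ⟨N, fun m hm n hn => ?_⟩
    have h0 := hN m hm n hn
    rw [dist_eq_norm] at h0 ⊢
    have e : L m x - L n x = L m (x - y) + (L m y - L n y) - L n (x - y) := by
      rw [map_sub, map_sub]; abel
    rw [e]
    have h1 := hC m (x - y)
    have h2 := hC n (x - y)
    have h3 := norm_sub_le (L m (x - y) + (L m y - L n y)) (L n (x - y))
    have h4 := norm_add_le (L m (x - y)) (L m y - L n y)
    linarith
  choose S hS using hcau
  let S' : X →ₗ[ℝ] X := linearMapOfTendsto S (fun n => (L n : X →ₗ[ℝ] X)) (l := atTop)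
    (tendsto_pi_nhds.2 hS)
  exact ⟨S'.mkContinuous C fun x => le_of_tendsto (hS x).norm
    (Eventually.of_forall fun n => hC n x), hS⟩

/-- The Yosida approximations `r² (r - A)⁻¹ - r`, along `r = 2γ + 1 + n`. -/
theorem IsQuasiMDissipative.exists_yosida [CompleteSpace X] {A : X →ₗ.[ℝ] X} {γ : ℝ}
    (hA : IsQuasiMDissipative A γ) (hγ : 0 ≤ γ) :
    ∃ B : ℕ → X →L[ℝ] X, (∀ m n, Commute (B m) (B n)) ∧
      (∀ n x, inner ℝ (B n x) x ≤ 4 * γ * ‖x‖ ^ 2) ∧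
      ∀ x : A.domain, Tendsto (fun n => B n x) atTop (𝓝 (A x)) := by
  let r : ℕ → ℝ := fun n => 2 * γ + 1 + n
  have hr1 : ∀ n, 2 * γ + 1 ≤ r n := fun n => by simp [r]
  have hr : ∀ n, γ < r n := fun n => by linarith [hr1 n]
  choose R hR hRl hRn using fun n => hA.exists_resolvent (hr n)
  have hJ : ∀ n x, ‖r n • R n x‖ ≤ 2 * ‖x‖ := fun n x => by
    have h0 : 0 < r n := by linarith [hr1 n]
    have h1 : 0 < r n - γ := by linarith [hr1 n]
    rw [norm_smul, Real.norm_of_nonneg h0.le]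
    calc r n * ‖R n x‖ ≤ r n * ((r n - γ)⁻¹ * ‖x‖) :=
          mul_le_mul_of_nonneg_left (hRn n x) h0.le
      _ = (r n / (r n - γ)) * ‖x‖ := by ring
      _ ≤ 2 * ‖x‖ := by
          refine mul_le_mul_of_nonneg_right ?_ (norm_nonneg _)
          rw [div_le_iff₀ h1]; linarith [hr1 n]
  -- the resolvent identity
  have hres : ∀ m n f, R m f - R n f = (r n - r m) • R m (R n f) := fun m n f => by
    obtain ⟨hm, em⟩ := hR m f
    obtain ⟨hn, en⟩ := hR n f
    have e := hRl m ⟨R n f, hn⟩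
    have e1 : r m • R n f - A ⟨R n f, hn⟩ = f - (r n - r m) • R n f := by
      rw [sub_smul]; nth_rewrite 3 [← en]; abel
    simp only at e
    rw [e1, map_sub, map_smul, sub_eq_iff_eq_add] at e
    rw [e]; abel
  have hcomm : ∀ m n, Commute (R m) (R n) := fun m n => by
    by_cases hmn : m = n
    · rw [hmn]
    · refine ContinuousLinearMap.ext fun f => ?_
      have h0 : r n - r m ≠ 0 := by
        simp only [r]
        intro h
        exact hmn (by exact_mod_cast (by linarith : (m : ℝ) = n))
      have h1 := hres m n f
      have h2 := hres n m f
      have h3 : (r n - r m) • (R m (R n f) - R n (R m f)) = 0 := by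
        rw [smul_sub, ← h1, ← neg_sub (r m), neg_smul, ← h2]; abel
      exact sub_eq_zero.1 ((smul_eq_zero.1 h3).resolve_left h0)
  refine ⟨fun n => (r n) ^ 2 • R n - r n • 1, fun m n => ?_, fun n x => ?_, fun x => ?_⟩
  · exact (((hcomm m n).smul_left _).smul_right _ |>.sub_left
      (((Commute.one_left _).smul_left _).smul_right _)).sub_right
      (((Commute.one_right _).smul_right _))
  · obtain ⟨hm, e⟩ := hR n x
    have h0 : 0 < r n := by linarith [hr1 n]
    -- with `z = r (r - A)⁻¹ x`, the approximation is `A z`, and `x = z - r⁻¹ A z`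
    set z : A.domain := r n • ⟨R n x, hm⟩ with hz
    have hzc : (z : X) = r n • R n x := rfl
    have hAz : A z = (r n) ^ 2 • R n x - r n • x := by
      rw [hz, A.map_smul]
      nth_rewrite 3 [← e]
      rw [smul_sub, smul_smul, ← sq]; abel
    have hx : x = (z : X) - (r n)⁻¹ • A z := by
      rw [hAz, hzc, smul_sub, smul_smul, smul_smul, inv_mul_cancel₀ h0.ne', sq,
        inv_mul_cancel_left₀ h0.ne', one_smul]; abel
    have e1 : ((r n) ^ 2 • R n - r n • (1 : X →L[ℝ] X)) x = A z := by
      rw [hAz]; simp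
    have h1 : inner ℝ (A z) x ≤ γ * ‖(z : X)‖ ^ 2 := by
      have e2 : inner ℝ (A z) x = inner ℝ (A z) ((z : X) - (r n)⁻¹ • A z) := congrArg _ hx
      rw [e2, inner_sub_right, real_inner_smul_right, real_inner_self_eq_norm_sq]
      have : 0 ≤ (r n)⁻¹ * ‖A z‖ ^ 2 := by positivity
      linarith [hA.inner_le z]
    rw [e1]
    have h2 : ‖(z : X)‖ ^ 2 ≤ (2 * ‖x‖) ^ 2 := pow_le_pow_left₀ (norm_nonneg _) (hJ n x) 2
    calc _ ≤ γ * (2 * ‖x‖) ^ 2 := h1.trans (mul_le_mul_of_nonneg_left h2 hγ)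
      _ = _ := by ring
  · have key : ∀ z, Tendsto (fun n => (r n • R n) z) atTop (𝓝 ((1 : X →L[ℝ] X) z)) := by
      refine tendsto_of_dense (C := 2) (Eventually.of_forall fun n z => hJ n z)
        hA.dense_domain fun z hz => ?_
      have e : ∀ n, (r n • R n) z = z + R n (A ⟨z, hz⟩) := fun n => by
        have := hRl n ⟨z, hz⟩
        simp only at this
        rw [map_sub, map_smul] at this
        rw [smul_apply]
        exact sub_eq_iff_eq_add.1 this
      simp only [e, one_apply_eq_self]
      have h0 : Tendsto (fun n => R n (A ⟨z, hz⟩)) atTop (𝓝 0) := by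
        refine squeeze_zero_norm (fun n => hRn n _) ?_
        have h1 : Tendsto (fun n => r n - γ) atTop atTop := by
          have : Tendsto (fun n : ℕ => (n : ℝ) + (γ + 1)) atTop atTop :=
            tendsto_atTop_add_const_right _ _ tendsto_natCast_atTop_atTop
          refine this.congr fun n => ?_
          simp only [r]; ring
        simpa using h1.inv_tendsto_atTop.mul_const ‖A ⟨z, hz⟩‖
      simpa using h0.const_add z
    refine (key (A x)).congr fun n => ?_
    have := hRl n x
    rw [map_sub, map_smul] at this
    have e1 : R n (A x) = r n • R n x - x := by
      rw [sub_eq_iff_eq_add] at this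
      rw [this]; abel
    simp [e1, smul_sub, smul_smul, sq]

end generation

/-! ### Generation of a semigroup -/

section semigroup_generation

variable {X : Type*} [NormedAddCommGroup X] [InnerProductSpace ℝ X]

/-- Grönwall's inequality in energy form: `⟪W', W⟫ ≤ K ‖W‖²` bounds the growth of `W`. -/
theorem norm_le_exp_mul {W W' : ℝ → X} {K : ℝ} (hc : ContinuousOn W (Ici 0))
    (hd : ∀ t, 0 < t → HasDerivAt W (W' t) t)
    (h : ∀ t, 0 < t → inner ℝ (W' t) (W t) ≤ K * ‖W t‖ ^ 2) {t : ℝ} (ht : 0 ≤ t) :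
    ‖W t‖ ≤ Real.exp (K * t) * ‖W 0‖ := by
  have hanti : AntitoneOn (fun t => Real.exp (-(2 * K) * t) * ‖W t‖ ^ 2) (Ici 0) := by
    refine antitoneOn_of_hasDerivWithinAt_nonpos (convex_Ici 0)
      (f' := fun t => Real.exp (-(2 * K) * t) * (2 * (inner ℝ (W' t) (W t) - K * ‖W t‖ ^ 2)))
      ((by fun_prop : Continuous fun t => Real.exp (-(2 * K) * t)).continuousOn.mul
        (hc.norm.pow 2)) (fun s hs => ?_) fun s hs => ?_
    · rw [interior_Ici] at hs
      have h1 : HasDerivAt (fun t : ℝ => Real.exp (-(2 * K) * t))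
          (Real.exp (-(2 * K) * s) * (-(2 * K) * 1)) s :=
        ((hasDerivAt_id s).const_mul (-(2 * K))).exp
      refine ((h1.mul (hd s hs).norm_sq).congr_deriv ?_).hasDerivWithinAt
      rw [real_inner_comm]; ring
    · rw [interior_Ici] at hs
      have := h s hs
      exact mul_nonpos_of_nonneg_of_nonpos (Real.exp_pos _).le (by linarith)
  have h1 := hanti (mem_Ici.2 le_rfl) (mem_Ici.2 ht) ht
  simp only [mul_zero, Real.exp_zero, one_mul] at h1
  refine le_of_sq_le (by positivity) ?_
  have h2 : Real.exp (K * t) ^ 2 * Real.exp (-(2 * K) * t) = 1 := by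
    rw [sq, ← Real.exp_add, ← Real.exp_add, Real.exp_eq_one_iff]; ring
  calc ‖W t‖ ^ 2 = Real.exp (K * t) ^ 2 * (Real.exp (-(2 * K) * t) * ‖W t‖ ^ 2) := by
        rw [← mul_assoc, h2, one_mul]
    _ ≤ Real.exp (K * t) ^ 2 * ‖W 0‖ ^ 2 := mul_le_mul_of_nonneg_left h1 (by positivity)
    _ = _ := (mul_pow _ _ _).symm

theorem exp_smul_apply_comm {B C : X →L[ℝ] X} (h : Commute B C) (t : ℝ) (x : X) :
    NormedSpace.exp (t • B) (C x) = C (NormedSpace.exp (t • B) x) :=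
  DFunLike.congr_fun ((h.smul_left t).exp_left) x

theorem C0Semigroup.continuous_op (S : C0Semigroup X) {K : ℝ} (hK : 0 ≤ K)
    (hS : ∀ (t : ℝ≥0) x, ‖S.op t x‖ ≤ Real.exp (K * t) * ‖x‖) (x : X) :
    Continuous fun t => S.op t x := by
  have hle : ∀ a b : ℝ≥0, ‖S.op (a + b) x - S.op a x‖ ≤ Real.exp (K * a) * ‖S.op b x - x‖ :=
    fun a b => by
      rw [S.op_add, ContinuousLinearMap.comp_apply, ← map_sub]; exact hS a _
  refine continuous_iff_continuousAt.2 fun t₀ => tendsto_iff_norm_sub_tendsto_zero.2 ?_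
  have h0 : Tendsto (fun t => Real.exp (K * (t₀ + 1)) * ‖S.op (nndist t t₀) x - x‖) (𝓝 t₀)
      (𝓝 0) := by
    have h1 : Tendsto (fun t => nndist t t₀) (𝓝 t₀) (𝓝 0) := by
      have : Continuous fun t => nndist t t₀ := by fun_prop
      simpa using this.tendsto t₀
    simpa using ((tendsto_iff_norm_sub_tendsto_zero.1 (S.tendsto_zero x)).comp h1).const_mul
      (Real.exp (K * (t₀ + 1)))
  refine squeeze_zero' (Eventually.of_forall fun _ => norm_nonneg _) ?_ h0
  filter_upwards [Iio_mem_nhds (show t₀ < t₀ + 1 from lt_add_one t₀)] with t ht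
  rcases le_total t₀ t with h | h
  · have e : t₀ + nndist t t₀ = t := by
      rw [NNReal.nndist_eq, tsub_eq_zero_of_le h, max_eq_left zero_le, add_tsub_cancel_of_le h]
    have := hle t₀ (nndist t t₀)
    rw [e] at this
    refine this.trans (mul_le_mul_of_nonneg_right (Real.exp_le_exp.2 ?_) (norm_nonneg _))
    exact mul_le_mul_of_nonneg_left (by linarith) hK
  · have e : t + nndist t t₀ = t₀ := by
      rw [NNReal.nndist_eq, tsub_eq_zero_of_le h, max_eq_right zero_le, add_tsub_cancel_of_le h]
    have := hle t (nndist t t₀)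
    rw [e] at this
    rw [norm_sub_rev]
    refine this.trans (mul_le_mul_of_nonneg_right (Real.exp_le_exp.2 ?_) (norm_nonneg _))
    have : (t : ℝ) ≤ t₀ := by exact_mod_cast h
    exact mul_le_mul_of_nonneg_left (by linarith) hK

variable [CompleteSpace X]

theorem hasDerivAt_exp_smul_apply (B : X →L[ℝ] X) (x : X) (t : ℝ) :
    HasDerivAt (fun t : ℝ => NormedSpace.exp (t • B) x) (NormedSpace.exp (t • B) (B x)) t := by
  simpa using (hasDerivAt_exp_smul_const B t).clm_apply (hasDerivAt_const t x)

theorem norm_exp_smul_apply_le {B : X →L[ℝ] X} {K : ℝ}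
    (h : ∀ x, inner ℝ (B x) x ≤ K * ‖x‖ ^ 2) {t : ℝ} (ht : 0 ≤ t) (x : X) :
    ‖NormedSpace.exp (t • B) x‖ ≤ Real.exp (K * t) * ‖x‖ := by
  have hd := hasDerivAt_exp_smul_apply B x
  have := norm_le_exp_mul (K := K) (W := fun t : ℝ => NormedSpace.exp (t • B) x)
    (fun t _ => (hd t).continuousAt.continuousWithinAt) (fun t _ => hd t)
    (fun t _ => by rw [exp_smul_apply_comm (Commute.refl B)]; exact h _) ht
  simpa using this

/-- Yosida's comparison of the flows of two commuting generators. -/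
theorem norm_exp_sub_exp_le {B C : X →L[ℝ] X} (hBC : Commute B C) {K : ℝ}
    (hB : ∀ x, inner ℝ (B x) x ≤ K * ‖x‖ ^ 2) (hC : ∀ x, inner ℝ (C x) x ≤ K * ‖x‖ ^ 2)
    {t : ℝ} (ht : 0 ≤ t) (x : X) :
    ‖NormedSpace.exp (t • B) x - NormedSpace.exp (t • C) x‖
      ≤ Real.exp (K * t) * ‖B x - C x‖ * t := by
  -- interpolate between the two sides by `s ↦ exp ((t - s) C) (exp (s B) x)`
  have hd : ∀ s : ℝ, HasDerivAt
      (fun s : ℝ => NormedSpace.exp ((t - s) • C) (NormedSpace.exp (s • B) x))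
      (NormedSpace.exp ((t - s) • C) (NormedSpace.exp (s • B) (B x - C x))) s := fun s => by
    have h1 : HasDerivAt (fun s : ℝ => NormedSpace.exp ((t - s) • C))
        ((-1 : ℝ) • (NormedSpace.exp ((t - s) • C) * C)) s :=
      (hasDerivAt_exp_smul_const C (t - s)).scomp s ((hasDerivAt_id s).const_sub t)
    refine (h1.clm_apply (hasDerivAt_exp_smul_apply B x s)).congr_deriv ?_
    simp only [map_sub, exp_smul_apply_comm hBC]
    rw [smul_apply, neg_one_smul, mul_apply_eq_comp]
    abel
  have hb : ∀ s ∈ Ico (0 : ℝ) t,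
      ‖NormedSpace.exp ((t - s) • C) (NormedSpace.exp (s • B) (B x - C x))‖
        ≤ Real.exp (K * t) * ‖B x - C x‖ := fun s hs => by
    refine (norm_exp_smul_apply_le hC (sub_nonneg.2 hs.2.le) _).trans ?_
    refine (mul_le_mul_of_nonneg_left (norm_exp_smul_apply_le hB hs.1 _)
      (Real.exp_pos _).le).trans ?_
    rw [← mul_assoc, ← Real.exp_add]
    exact le_of_eq (by ring_nf)
  have := norm_image_sub_le_of_norm_deriv_le_segment' (fun s _ => (hd s).hasDerivWithinAt) hb t
    (right_mem_Icc.2 ht)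
  simpa using this

theorem exp_smul_apply_sub (B : X →L[ℝ] X) (x : X) (t : ℝ) :
    NormedSpace.exp (t • B) x - x = ∫ s in (0 : ℝ)..t, NormedSpace.exp (s • B) (B x) := by
  rw [intervalIntegral.integral_eq_sub_of_hasDerivAt
    (fun s _ => hasDerivAt_exp_smul_apply B x s)]
  · simp
  · exact (continuous_iff_continuousAt.2 fun s =>
      (hasDerivAt_exp_smul_apply B (B x) s).continuousAt).intervalIntegrable _ _

/-- The Hille–Yosida construction: the semigroup is the limit of the exponentials of the Yosida
approximations, and `S(t) x - x = ∫₀ᵗ S(s) A x ds` on the domain. -/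
theorem IsQuasiMDissipative.exists_semigroup {A : X →ₗ.[ℝ] X} {γ : ℝ}
    (hA : IsQuasiMDissipative A γ) (hγ : 0 ≤ γ) :
    ∃ S : C0Semigroup X, (∀ (t : ℝ≥0) x, ‖S.op t x‖ ≤ Real.exp (4 * γ * t) * ‖x‖) ∧
      ∀ (x : A.domain) (t : ℝ≥0),
        S.op t x - x = ∫ s in (0 : ℝ)..t, S.op s.toNNReal (A x) := by
  obtain ⟨B, hcomm, hB, hlim⟩ := hA.exists_yosida hγ
  set K : ℝ := 4 * γ with hK
  have hK0 : 0 ≤ K := by positivity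
  have hE : ∀ n (t : ℝ≥0) x, ‖NormedSpace.exp ((t : ℝ) • B n) x‖ ≤ Real.exp (K * t) * ‖x‖ :=
    fun n t x => norm_exp_smul_apply_le (hB n) t.2 x
  have hex : ∀ t : ℝ≥0, ∃ S : X →L[ℝ] X, ∀ x,
      Tendsto (fun n => NormedSpace.exp ((t : ℝ) • B n) x) atTop (𝓝 (S x)) := fun t => by
    refine exists_limit_of_dense (Real.exp_pos _).le (fun n x => hE n t x) hA.dense_domain
      fun x hx => ?_
    refine Metric.cauchySeq_iff.2 fun ε hε => ?_
    have hc : 0 < Real.exp (K * t) * t + 1 := by positivity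
    obtain ⟨N, hN⟩ := Metric.cauchySeq_iff.1 (hlim ⟨x, hx⟩).cauchySeq
      (ε / (Real.exp (K * t) * t + 1)) (by positivity)
    refine ⟨N, fun m hm n hn => ?_⟩
    have h1 := hN m hm n hn
    have h2 := norm_exp_sub_exp_le (hcomm m n) (hB m) (hB n) t.2 x
    rw [dist_eq_norm, lt_div_iff₀ hc] at h1
    rw [dist_eq_norm]
    simp only [NNReal.val_eq_coe] at h2
    nlinarith [norm_nonneg (B m x - B n x)]
  choose S hS using hex
  have hSn : ∀ (t : ℝ≥0) x, ‖S t x‖ ≤ Real.exp (K * t) * ‖x‖ := fun t x =>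
    le_of_tendsto (hS t x).norm (Eventually.of_forall fun n => hE n t x)
  have hS0 : S 0 = ContinuousLinearMap.id ℝ X := by
    refine ContinuousLinearMap.ext fun x => tendsto_nhds_unique (hS 0 x) ?_
    simp
  have hSadd : ∀ s t, S (s + t) = (S s).comp (S t) := fun s t => by
    refine ContinuousLinearMap.ext fun x => tendsto_nhds_unique (hS (s + t) x) ?_
    have e : ∀ n, NormedSpace.exp (((s + t : ℝ≥0) : ℝ) • B n) x
        = NormedSpace.exp ((s : ℝ) • B n) (NormedSpace.exp ((t : ℝ) • B n) x) := fun n => by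
      let _ : NormedAlgebra ℚ (X →L[ℝ] X) := .restrictScalars ℚ ℝ _
      rw [NNReal.coe_add, add_smul, NormedSpace.exp_add_of_commute
        (((Commute.refl (B n)).smul_left _).smul_right _)]
      rfl
    simp only [e, ContinuousLinearMap.comp_apply]
    have h1 : Tendsto (fun n => NormedSpace.exp ((s : ℝ) • B n)
        (NormedSpace.exp ((t : ℝ) • B n) x - S t x)) atTop (𝓝 0) := by
      refine squeeze_zero_norm (fun n => hE n s _) ?_
      simpa using (tendsto_iff_norm_sub_tendsto_zero.1 (hS t x)).const_mul (Real.exp (K * s))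
    simpa using h1.add (hS s (S t x))
  have hdom : ∀ (x : A.domain) (t : ℝ≥0), ‖S t x - x‖ ≤ Real.exp (K * t) * ‖A x‖ * t :=
    fun x t => by
      refine le_of_tendsto_of_tendsto' ((hS t x).sub_const (x : X)).norm
        (((hlim x).norm.const_mul (Real.exp (K * t))).mul_const (t : ℝ)) fun n => ?_
      have := norm_exp_sub_exp_le (Commute.zero_right (B n)) (hB n)
        (fun z => by simpa using by positivity) t.2 (x : X)
      simpa using this
  have htend : ∀ x, Tendsto (fun t => S t x) (𝓝 0) (𝓝 ((ContinuousLinearMap.id ℝ X) x)) := by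
    refine tendsto_of_dense (C := Real.exp (K * 1)) ?_ hA.dense_domain fun x hx => ?_
    · filter_upwards [Iio_mem_nhds (show (0 : ℝ≥0) < 1 from one_pos)] with t ht z
      refine (hSn t z).trans (mul_le_mul_of_nonneg_right (Real.exp_le_exp.2 ?_) (norm_nonneg _))
      exact mul_le_mul_of_nonneg_left (by exact_mod_cast (le_of_lt ht)) hK0
    · refine tendsto_iff_norm_sub_tendsto_zero.2 ?_
      refine squeeze_zero (fun _ => norm_nonneg _) (fun t => hdom ⟨x, hx⟩ t) ?_
      have : Continuous fun t : ℝ≥0 => Real.exp (K * t) * ‖A ⟨x, hx⟩‖ * t := by fun_prop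
      simpa using this.tendsto 0
  let T : C0Semigroup X := ⟨S, hS0, hSadd, htend⟩
  refine ⟨T, hSn, fun x t => tendsto_nhds_unique ((hS t x).sub_const (x : X)) ?_⟩
  simp only [exp_smul_apply_sub]
  obtain ⟨M, hM⟩ := (hlim x).norm.bddAbove_range
  refine intervalIntegral.tendsto_integral_filter_of_dominated_convergence
    (fun _ => Real.exp (K * t) * M) (Eventually.of_forall fun n => ?_)
    (Eventually.of_forall fun n => Eventually.of_forall fun s hs => ?_)
    intervalIntegrable_const (Eventually.of_forall fun s hs => ?_)
  · exact (continuous_iff_continuousAt.2 fun s =>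
      (hasDerivAt_exp_smul_apply (B n) (B n x) s).continuousAt).aestronglyMeasurable
  · rw [uIoc_of_le t.coe_nonneg] at hs
    refine (norm_exp_smul_apply_le (hB n) hs.1.le _).trans ?_
    exact mul_le_mul (Real.exp_le_exp.2 (mul_le_mul_of_nonneg_left hs.2 hK0))
      (hM ⟨n, rfl⟩) (norm_nonneg _) (Real.exp_pos _).le
  · rw [uIoc_of_le t.coe_nonneg] at hs
    lift s to ℝ≥0 using hs.1.le
    rw [Real.toNNReal_coe]
    have h1 : Tendsto (fun n => NormedSpace.exp ((s : ℝ) • B n) (B n x - A x)) atTop (𝓝 0) := by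
      refine squeeze_zero_norm (fun n => hE n s _) ?_
      simpa using (tendsto_iff_norm_sub_tendsto_zero.1 (hlim x)).const_mul (Real.exp (K * s))
    simpa using h1.add (hS s (A x))

end semigroup_generation

/-! ### The Cauchy problem -/

section cauchy_problem

variable {X : Type*} [NormedAddCommGroup X] [InnerProductSpace ℝ X]

theorem tendsto_slope_nnreal {f : ℝ → X} {f' : X} (h : HasDerivAt f f' 0) :
    Tendsto (fun t : ℝ≥0 => (t : ℝ)⁻¹ • (f t - f 0)) (𝓝[>] 0) (𝓝 f') := by
  have h1 : Tendsto (fun t : ℝ≥0 => (t : ℝ)) (𝓝[>] 0) (𝓝[≠] 0) := by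
    refine tendsto_nhdsWithin_iff.2 ⟨?_, ?_⟩
    · exact (NNReal.continuous_coe.tendsto 0).mono_left nhdsWithin_le_nhds
    · filter_upwards [self_mem_nhdsWithin] with t ht
      exact (NNReal.coe_pos.2 ht).ne'
  refine ((hasDerivAt_iff_tendsto_slope.1 h).comp h1).congr fun t => ?_
  simp [slope_def_module]

/-- The orbit `t ↦ S(t) x` on `[0, ∞)`, continued by the constant `x` to negative times. -/
def C0Semigroup.orbit (S : C0Semigroup X) (x : X) (t : ℝ) : X := S.op t.toNNReal x

namespace C0Semigroup

variable (S : C0Semigroup X)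

theorem orbit_coe (x : X) (t : ℝ≥0) : S.orbit x t = S.op t x := by
  rw [orbit, Real.toNNReal_coe]

theorem orbit_zero (x : X) : S.orbit x 0 = x := by
  rw [orbit, Real.toNNReal_zero, S.op_zero]; rfl

theorem op_orbit (x : X) (h : ℝ≥0) {s : ℝ} (hs : 0 ≤ s) :
    S.op h (S.orbit x s) = S.orbit x (s + h) := by
  lift s to ℝ≥0 using hs
  rw [← NNReal.coe_add, orbit_coe, orbit_coe, add_comm, S.op_add]; rfl

theorem continuous_orbit {K : ℝ} (hK : 0 ≤ K)
    (hS : ∀ (t : ℝ≥0) x, ‖S.op t x‖ ≤ Real.exp (K * t) * ‖x‖) (x : X) :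
    Continuous (S.orbit x) :=
  (S.continuous_op hK hS x).comp continuous_real_toNNReal

end C0Semigroup

/-- The domain is invariant under the semigroup, and `A` commutes with `S(t)` on it. -/
theorem IsGenerator.op_mem {A : X →ₗ.[ℝ] X} {S : C0Semigroup X}
    (hG : IsGenerator A S) (x : A.domain) (t : ℝ≥0) :
    ∃ h : S.op t x ∈ A.domain, A ⟨S.op t x, h⟩ = S.op t (A x) := by
  refine (hG _ _).2 ?_
  refine (((S.op t).continuous.tendsto _).comp ((hG x (A x)).1 ⟨x.2, rfl⟩)).congr fun h => ?_
  simp only [Function.comp_apply, map_smul, map_sub]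
  rw [← ContinuousLinearMap.comp_apply, ← ContinuousLinearMap.comp_apply, ← S.op_add,
    ← S.op_add, add_comm]

theorem hasDerivAt_primitive [CompleteSpace X] {f : ℝ → X} (hf : Continuous f) (t : ℝ) :
    HasDerivAt (fun t => ∫ s in (0 : ℝ)..t, f s) (f t) t :=
  intervalIntegral.integral_hasDerivAt_right (hf.intervalIntegrable _ _)
    (hf.stronglyMeasurableAtFilter _ _) hf.continuousAt

variable [CompleteSpace X] {A : X →ₗ.[ℝ] X} {γ : ℝ}

/-- The generator of `S` is `A` itself and not a proper extension of it. -/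
theorem IsQuasiMDissipative.isGenerator (hA : IsQuasiMDissipative A γ) {S : C0Semigroup X}
    {K : ℝ} (hK : 0 ≤ K) (hS : ∀ (t : ℝ≥0) x, ‖S.op t x‖ ≤ Real.exp (K * t) * ‖x‖)
    (hint : ∀ (x : A.domain) (t : ℝ≥0),
      S.op t x - x = ∫ s in (0 : ℝ)..t, S.op s.toNNReal (A x)) :
    IsGenerator A S := by
  have fwd : ∀ x : A.domain,
      Tendsto (fun t : ℝ≥0 => (t : ℝ)⁻¹ • (S.op t x - x)) (𝓝[>] 0) (𝓝 (A x)) := fun x => by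
    have h := tendsto_slope_nnreal (hasDerivAt_primitive (S.continuous_orbit hK hS (A x)) 0)
    rw [S.orbit_zero] at h
    refine h.congr fun t => ?_
    rw [hint x t, intervalIntegral.integral_same, sub_zero]; rfl
  refine fun x z => ⟨?_, fun hz => ?_⟩
  · rintro ⟨hx, rfl⟩
    exact fwd ⟨x, hx⟩
  -- for `r` large, the difference `d` of `x` and `(r - A)⁻¹ (r x - z)` is an eigenvector of the
  -- generator for the eigenvalue `r`, which exceeds the growth bound of `S`
  obtain ⟨r, hr, hKr⟩ : ∃ r, γ < r ∧ K < r :=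
    ⟨max γ K + 1, by linarith [le_max_left γ K], by linarith [le_max_right γ K]⟩
  obtain ⟨x', hx'⟩ := hA.range r hr (r • x - z)
  set d : X := x - x' with hd
  have hzd : z - A x' = r • d := by
    rw [hd, smul_sub, sub_eq_sub_iff_add_eq_add]
    rw [sub_eq_sub_iff_add_eq_add] at hx'
    rw [add_comm, hx', add_comm]
  have h1 : Tendsto (fun t : ℝ≥0 => (t : ℝ)⁻¹ • (S.op t d - d)) (𝓝[>] 0) (𝓝 (r • d)) := by
    rw [← hzd]
    refine (hz.sub (fwd x')).congr fun t => ?_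
    rw [← smul_sub, hd, map_sub]; congr 1; abel
  have h2 : Tendsto (fun t : ℝ≥0 => inner ℝ ((t : ℝ)⁻¹ • (S.op t d - d)) d) (𝓝[>] 0)
      (𝓝 (inner ℝ (r • d) d)) := h1.inner tendsto_const_nhds
  have h3 : Tendsto (fun t : ℝ≥0 => ((t : ℝ)⁻¹ • (Real.exp (K * t) - Real.exp (K * 0)))
      * ‖d‖ ^ 2) (𝓝[>] 0) (𝓝 (K * ‖d‖ ^ 2)) := by
    refine (tendsto_slope_nnreal (X := ℝ) (f := fun t => Real.exp (K * t)) ?_).mul_const _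
    have := ((hasDerivAt_id (0 : ℝ)).const_mul K).exp
    simpa using this
  have h4 : inner ℝ (r • d) d ≤ K * ‖d‖ ^ 2 := by
    refine le_of_tendsto_of_tendsto' h2 h3 fun t => ?_
    rw [real_inner_smul_left, smul_eq_mul, mul_assoc, mul_zero, Real.exp_zero, inner_sub_left,
      real_inner_self_eq_norm_sq]
    refine mul_le_mul_of_nonneg_left ?_ (by positivity)
    have h5 := (real_inner_le_norm (S.op t d) d).trans
      (mul_le_mul_of_nonneg_right (hS t d) (norm_nonneg d))
    nlinarith
  rw [real_inner_smul_left, real_inner_self_eq_norm_sq] at h4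
  have hd0 : d = 0 := by
    have : ‖d‖ ^ 2 = 0 := by nlinarith [sq_nonneg ‖d‖]
    exact norm_eq_zero.1 ((pow_eq_zero_iff two_ne_zero).1 this)
  have hxx : x = x' := sub_eq_zero.1 hd0
  refine ⟨hxx ▸ x'.2, ?_⟩
  rw [hd0, smul_zero, sub_eq_zero] at hzd
  rw [hzd]
  exact congrArg A (Subtype.ext hxx)

/-- With `F(t) = ∫₀ᵗ S(s) x ds`, one has `S(h) F(t) - F(t) = (F(t + h) - F(h)) - F(t)`, so that
`A F(t) = F'(t) - F'(0) = S(t) x - x`. -/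
theorem IsGenerator.isMildSolution {S : C0Semigroup X} (hG : IsGenerator A S) {x : X}
    (hc : Continuous (S.orbit x)) : IsMildSolution A x (S.orbit x) := by
  refine ⟨hc.continuousOn, fun t ht => ?_⟩
  set F : ℝ → X := fun r => ∫ s in (0 : ℝ)..r, S.orbit x s with hF
  have hd : HasDerivAt (fun h => F (t + h) - F h) (S.orbit x t - x) 0 := by
    have h1 : HasDerivAt (fun h => F (t + h)) (S.orbit x t) 0 := by
      refine HasDerivAt.comp_const_add t 0 ?_
      rw [add_zero]; exact hasDerivAt_primitive hc t
    have h2 := h1.sub (hasDerivAt_primitive hc 0)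
    rwa [S.orbit_zero] at h2
  have hshift : ∀ h : ℝ≥0, S.op h (F t) = F (t + h) - F h := fun h => by
    have h1 : S.op h (F t) = ∫ s in (0 : ℝ)..t, S.orbit x (s + h) := by
      rw [hF, ← (S.op h).intervalIntegral_comp_comm (hc.intervalIntegrable _ _)]
      refine intervalIntegral.integral_congr fun s hs => ?_
      rw [uIcc_of_le ht] at hs
      exact S.op_orbit x h hs.1
    rw [h1, intervalIntegral.integral_comp_add_right, zero_add,
      ← intervalIntegral.integral_interval_sub_left (hc.intervalIntegrable 0 _)
        (hc.intervalIntegrable 0 _)]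
  obtain ⟨hm, he⟩ := (hG (F t) (S.orbit x t - x)).2 <| by
    refine (tendsto_slope_nnreal hd).congr fun h => ?_
    rw [hshift h]
    simp [hF]
  exact ⟨hm, by rw [he]; abel⟩

/-- Two mild solutions coincide: the primitive `W` of their difference satisfies `W' = A W`,
`W(0) = 0`. -/
theorem IsQuasiMDissipative.mild_unique (hA : IsQuasiMDissipative A γ) {x : X} {Y Z : ℝ → X}
    (hY : IsMildSolution A x Y) (hZ : IsMildSolution A x Z) : EqOn Z Y (Ici 0) := by
  have hext : ∀ {Y : ℝ → X}, ContinuousOn Y (Ici 0) → Continuous fun t => Y (max t 0) :=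
    fun h => h.comp_continuous (by fun_prop) fun t => le_max_right t 0
  have hcY := hext hY.1
  have hcZ := hext hZ.1
  have hcong : ∀ (Y : ℝ → X) {t : ℝ}, 0 ≤ t →
      ∫ s in (0 : ℝ)..t, Y (max s 0) = ∫ s in (0 : ℝ)..t, Y s := fun Y t ht =>
    intervalIntegral.integral_congr fun s hs => by
      rw [uIcc_of_le ht] at hs
      simp only [max_eq_left hs.1]
  set W : ℝ → X := fun t => ∫ s in (0 : ℝ)..t, (Z (max s 0) - Y (max s 0)) with hW
  have hAW : ∀ t, 0 ≤ t → ∃ h : W t ∈ A.domain, A ⟨W t, h⟩ = Z t - Y t := fun t ht => by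
    obtain ⟨h1, e1⟩ := hY.2 t ht
    obtain ⟨h2, e2⟩ := hZ.2 t ht
    have e : W t = (∫ s in (0 : ℝ)..t, Z s) - ∫ s in (0 : ℝ)..t, Y s := by
      rw [hW, ← hcong Z ht, ← hcong Y ht]
      exact intervalIntegral.integral_sub (hcZ.intervalIntegrable _ _) (hcY.intervalIntegrable _ _)
    refine ⟨e ▸ sub_mem h2 h1, ?_⟩
    have e3 : (⟨W t, e ▸ sub_mem h2 h1⟩ : A.domain) = ⟨_, h2⟩ - ⟨_, h1⟩ := Subtype.ext e
    rw [e3, A.map_sub, e2, e1]; abel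
  have hd : ∀ t, HasDerivAt W (Z (max t 0) - Y (max t 0)) t :=
    hasDerivAt_primitive (hcZ.sub hcY)
  intro t ht
  have h0 : ‖W t‖ ≤ 0 := by
    have := norm_le_exp_mul (K := γ) (fun t _ => (hd t).continuousAt.continuousWithinAt)
      (fun t _ => hd t) (fun t ht => by
        obtain ⟨h, e⟩ := hAW t ht.le
        rw [max_eq_left ht.le, ← e]
        exact hA.inner_le ⟨W t, h⟩) (mem_Ici.1 ht)
    simpa [hW] using this
  obtain ⟨h, e⟩ := hAW t ht
  have h1 : (⟨W t, h⟩ : A.domain) = 0 := Subtype.ext (norm_le_zero_iff.1 h0)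
  rw [h1, A.map_zero] at e
  exact (sub_eq_zero.1 e.symm)

theorem IsGenerator.isClassicalSolution {S : C0Semigroup X} (hG : IsGenerator A S)
    (hc : ∀ x, Continuous (S.orbit x))
    (hint : ∀ (x : A.domain) (t : ℝ≥0),
      S.op t x - x = ∫ s in (0 : ℝ)..t, S.op s.toNNReal (A x))
    (x : A.domain) : IsClassicalSolution A x (S.orbit x) := by
  have hd : ∀ t : ℝ, 0 ≤ t → HasDerivWithinAt (S.orbit x) (S.orbit (A x) t) (Ici 0) t :=
    fun t ht => by
      have h1 := ((hasDerivAt_primitive (hc (A x)) t).const_add (x : X)).hasDerivWithinAt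
        (s := Ici 0)
      have h2 : ∀ s ∈ Ici (0 : ℝ), S.orbit x s = x + ∫ r in (0 : ℝ)..s, S.orbit (A x) r := by
        intro s hs
        lift s to ℝ≥0 using hs
        rw [S.orbit_coe, ← sub_eq_iff_eq_add']
        exact hint x s
      exact h1.congr h2 (h2 t ht)
  refine ⟨S.orbit_zero _, ?_, fun t => (hG.op_mem x _).1, ?_, fun t => ?_⟩
  · refine (contDiffOn_one_iff_derivWithin (uniqueDiffOn_Ici 0)).2
      ⟨fun t ht => (hd t ht).differentiableWithinAt, ?_⟩
    exact (hc (A x)).continuousOn.congr fun t ht => (hd t ht).derivWithin (uniqueDiffOn_Ici 0 t ht)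
  · refine ((hc x).comp continuous_subtype_val).prodMk ?_
    refine ((hc (A x)).comp continuous_subtype_val).congr fun t => ?_
    exact (hG.op_mem x _).2.symm
  · have h := (hG.op_mem x (t : ℝ).toNNReal).2
    have h1 := hd t t.2
    rw [C0Semigroup.orbit, ← h] at h1
    exact h1

/-- A quasi-m-dissipative operator generates a `C₀`-semigroup, and its Cauchy problem is
well-posed. -/
theorem IsQuasiMDissipative.wellPosed (hA : IsQuasiMDissipative A γ) (hγ : 0 ≤ γ) :
    ∃ S : C0Semigroup X, IsGenerator A S ∧
      ∀ Y₀ : X, ∃ Y : ℝ → X, IsMildSolution A Y₀ Y ∧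
        (∀ Z : ℝ → X, IsMildSolution A Y₀ Z → EqOn Z Y (Ici 0)) ∧
        (∀ t : ℝ≥0, Y t = S.op t Y₀) ∧ (Y₀ ∈ A.domain → IsClassicalSolution A Y₀ Y) := by
  obtain ⟨S, hS, hint⟩ := hA.exists_semigroup hγ
  have hK : 0 ≤ 4 * γ := by positivity
  have hG := hA.isGenerator hK hS hint
  have hc := S.continuous_orbit hK hS
  refine ⟨S, hG, fun Y₀ => ⟨S.orbit Y₀, hG.isMildSolution (hc Y₀), fun Z hZ => ?_,
    S.orbit_coe Y₀, fun h => hG.isClassicalSolution hc hint ⟨Y₀, h⟩⟩⟩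
  exact hA.mild_unique (hG.isMildSolution (hc Y₀)) hZ

end cauchy_problem

/-! ### Integration by parts and primitives in `L²(a, b)` -/

section primitives

variable {a b : ℝ}

theorem HasWeakDeriv.coe_add {f g f₁ g₁ : L2 a b} (h : HasWeakDeriv a b f g)
    (h₁ : HasWeakDeriv a b f₁ g₁) : HasWeakDeriv a b (f + f₁ : L2 a b) (g + g₁ : L2 a b) :=
  (h.add h₁).congr (Lp.coeFn_add _ _) (Lp.coeFn_add _ _)

theorem HasWeakDeriv.coe_smul {f g : L2 a b} (c : ℝ) (h : HasWeakDeriv a b f g) :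
    HasWeakDeriv a b (c • f : L2 a b) (c • g : L2 a b) :=
  (h.smul c).congr (Lp.coeFn_smul _ _) (Lp.coeFn_smul _ _)

theorem HasWeakDeriv.coe_sub {f g f₁ g₁ : L2 a b} (h : HasWeakDeriv a b f g)
    (h₁ : HasWeakDeriv a b f₁ g₁) : HasWeakDeriv a b (f - f₁ : L2 a b) (g - g₁ : L2 a b) := by
  have := h.coe_add (h₁.coe_smul (-1))
  simpa only [neg_one_smul, ← sub_eq_add_neg] using this

theorem HasWeakDeriv.mem_sobolev {k : ℕ} {f g : L2 a b} (h : HasWeakDeriv a b f g)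
    (hg : g ∈ sobolev a b k) : f ∈ sobolev a b (k + 1) :=
  mem_sobolev_succ.2 ⟨g, hg, h⟩

theorem HasWeakDeriv.mem_sobolev_one {f g : L2 a b} (h : HasWeakDeriv a b f g) :
    f ∈ sobolev a b 1 :=
  h.mem_sobolev (k := 0) Submodule.mem_top

theorem contRep_sub (hab : a < b) {k : ℕ} {f f₁ : L2 a b} (h : f ∈ sobolev a b (k + 1))
    (h₁ : f₁ ∈ sobolev a b (k + 1)) {x : ℝ} (hx : x ∈ Icc a b) :
    contRep a b (f - f₁ : L2 a b) x = contRep a b f x - contRep a b f₁ x := by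
  have := contRep_add hab h (Submodule.smul_mem _ (-1) h₁) hx
  rw [contRep_smul hab (-1) h₁ hx, neg_one_smul, ← sub_eq_add_neg] at this
  rw [this]; ring

theorem HasWeakDeriv.integral_mul_eq (hab : a < b) {f f' g g' : ℝ → ℝ}
    (hf : HasWeakDeriv a b f f') (hg : HasWeakDeriv a b g g') :
    ∫ x in Ioo a b, f x * g' x = contRep a b f b * contRep a b g b
      - contRep a b f a * contRep a b g a - ∫ x in Ioo a b, f' x * g x := by
  have aux : ∀ {f f' : ℝ → ℝ}, HasWeakDeriv a b f f' → ∃ F, f =ᵐ[leb a b] F ∧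
      F a = contRep a b f a ∧ F b = contRep a b f b ∧
      AbsolutelyContinuousOnInterval F a b ∧ deriv F =ᵐ[leb a b] f' := by
    intro f f' h
    obtain ⟨F, hF, hF'⟩ := h.exists_contRep hab
    have hi : IntervalIntegrable f' volume a b := by
      rw [intervalIntegrable_iff_integrableOn_Ioo_of_le hab.le]; exact h.2.1
    have hFe : F = fun x => F a + ∫ t in a..x, f' t := funext hF'
    have hac : AbsolutelyContinuousOnInterval F a b := by
      rw [hFe]
      exact (contDiffOn_const (c := F a)).absolutelyContinuousOnInterval.add
        (hi.absolutelyContinuousOnInterval_intervalIntegral left_mem_uIcc)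
    refine ⟨F, hF.2, (contRep_eqOn hab hF (left_mem_Icc.2 hab.le)).symm,
      (contRep_eqOn hab hF (right_mem_Icc.2 hab.le)).symm, hac, ?_⟩
    refine (ae_restrict_iff' measurableSet_Ioo).2 ?_
    filter_upwards [hi.ae_hasDerivAt_integral] with x hx hxm
    rw [hFe]
    exact ((hx (by rw [uIcc_of_le hab.le]; exact Ioo_subset_Icc_self hxm) a
      left_mem_uIcc).const_add (F a)).deriv
  obtain ⟨F, hfF, hFa, hFb, hFac, hF'⟩ := aux hf
  obtain ⟨G, hgG, hGa, hGb, hGac, hG'⟩ := aux hg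
  have key := hFac.integral_mul_deriv_eq_deriv_mul hGac
  rw [intervalIntegral.integral_of_le hab.le, intervalIntegral.integral_of_le hab.le,
    integral_Ioc_eq_integral_Ioo, integral_Ioc_eq_integral_Ioo, hFa, hFb, hGa, hGb] at key
  have e1 : ∫ x in Ioo a b, f x * g' x = ∫ x in Ioo a b, F x * deriv G x :=
    integral_congr_ae (by filter_upwards [hfF, hG'] with x h1 h2; rw [h1, h2])
  have e2 : ∫ x in Ioo a b, f' x * g x = ∫ x in Ioo a b, deriv F x * G x :=
    integral_congr_ae (by filter_upwards [hgG, hF'] with x h1 h2; rw [h1, h2])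
  rw [e1, e2, key]

theorem L2.inner_eq_integral (f g : L2 a b) : inner ℝ f g = ∫ x in Ioo a b, f x * g x := by
  rw [MeasureTheory.L2.inner_def]
  refine integral_congr_ae (Eventually.of_forall fun x => ?_)
  simp [mul_comm]

/-- Integration by parts in `H¹(a, b)`. -/
theorem HasWeakDeriv.inner_eq (hab : a < b) {f f' g g' : L2 a b}
    (hf : HasWeakDeriv a b f f') (hg : HasWeakDeriv a b g g') :
    inner ℝ f g' = contRep a b f b * contRep a b g b
      - contRep a b f a * contRep a b g a - inner ℝ f' g := by
  rw [L2.inner_eq_integral, L2.inner_eq_integral, hf.integral_mul_eq hab hg]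

/-- The Volterra operator: `V f` is the primitive of `f` vanishing at `a`. -/
theorem exists_volterra (hab : a < b) : ∃ V : L2 a b →L[ℝ] L2 a b,
    ∀ f, HasWeakDeriv a b (V f) f ∧ contRep a b (V f) a = 0 := by
  have ha : a ∈ Icc a b := left_mem_Icc.2 hab.le
  obtain ⟨C, -, hC⟩ := exists_norm_le a b
  choose P hP hP0 using exists_primitive hab
  have huniq : ∀ f g : L2 a b, HasWeakDeriv a b g f → contRep a b g a = 0 → g = P f := by
    intro f g hg hg0
    have h1 := hg.coe_sub (hP f)
    have h2 := hC 0 (g - P f) hab h1.mem_sobolev_one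
      (by rw [contRep_sub hab hg.mem_sobolev_one (hP f).mem_sobolev_one ha, hg0, hP0, sub_zero])
    rw [wderiv_eq h1, sub_self, norm_zero, mul_zero] at h2
    exact sub_eq_zero.1 (norm_le_zero_iff.1 h2)
  let V : L2 a b →ₗ[ℝ] L2 a b :=
    { toFun := P
      map_add' := fun f g => (huniq _ _ ((hP f).coe_add (hP g)) (by
        rw [contRep_add hab (hP f).mem_sobolev_one (hP g).mem_sobolev_one ha, hP0, hP0,
          add_zero])).symm
      map_smul' := fun c f => (huniq _ _ ((hP f).coe_smul c) (by
        rw [contRep_smul hab c (hP f).mem_sobolev_one ha, hP0, mul_zero])).symm }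
  refine ⟨V.mkContinuous C fun f => ?_, fun f => ⟨hP f, hP0 f⟩⟩
  have := hC 0 (P f) hab (hP f).mem_sobolev_one (hP0 f)
  rwa [wderiv_eq (hP f)] at this

/-- The constant function `1` in `L²(a, b)`. -/
noncomputable def oneL2 (a b : ℝ) : L2 a b := Lp.const 2 (leb a b) (1 : ℝ)

theorem oneL2_ae : oneL2 a b =ᵐ[leb a b] fun _ => (1 : ℝ) := Lp.coeFn_const 2 (leb a b) (1 : ℝ)

theorem hasWeakDeriv_oneL2 : HasWeakDeriv a b (oneL2 a b) (0 : L2 a b) := by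
  refine HasWeakDeriv.congr (f := fun _ => 1) (g := fun _ => 0) ?_ oneL2_ae (Lp.coeFn_zero _ _ _)
  refine ⟨integrable_const _, integrable_zero _ _ _, fun φ hφ => ?_⟩
  simp only [one_mul, zero_mul, integral_zero, neg_zero]
  rw [setIntegral_eq_integral_of_forall_compl_eq_zero (f := deriv φ) fun x hx =>
    image_eq_zero_of_notMem_tsupport fun h => hx (hφ.deriv.2.2 h)]
  exact integral_eq_zero_of_hasDerivAt_of_integrable
    (fun x => (hφ.1.differentiable (by simp) x).hasDerivAt)
    (hφ.deriv.1.continuous.integrable_of_hasCompactSupport hφ.deriv.2.1)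
    (hφ.1.continuous.integrable_of_hasCompactSupport hφ.2.1)

theorem contRep_oneL2 (hab : a < b) {x : ℝ} (hx : x ∈ Icc a b) :
    contRep a b (oneL2 a b) x = 1 :=
  contRep_eqOn hab (F := fun _ => 1) ⟨continuousOn_const, oneL2_ae⟩ hx

end primitives

/-! ### The stationary beam equation -/

theorem surjective_of_coercive {X : Type*} [NormedAddCommGroup X] [InnerProductSpace ℝ X]
    [CompleteSpace X] (M : X →L[ℝ] X) (hM : ∀ x, ‖x‖ ^ 2 ≤ inner ℝ (M x) x) :
    Function.Surjective M := by
  have hco : IsCoercive ((innerSL ℝ).comp M) :=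
    ⟨1, one_pos, fun x => by simpa [sq] using hM x⟩
  intro f
  refine ⟨hco.continuousLinearEquivOfBilin.symm f, ?_⟩
  have h := hco.unique_continuousLinearEquivOfBilin
    (v := hco.continuousLinearEquivOfBilin.symm f)
    (f := M (hco.continuousLinearEquivOfBilin.symm f)) fun w => by simp
  rw [h, ContinuousLinearEquiv.apply_symm_apply]

/-- The boundary value problem `y'''' - T y'' + c y = G`, `y(0) = y'(0) = y''(ℓ) = 0`,
`y'''(ℓ) - T y'(ℓ) = k y(ℓ) - m`. With `V` the primitive from `0` and `W = V*` the one from `ℓ`,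
the unknown `w = y''` satisfies the coercive equation
`w + W (T V w + c W V² w + k ⟪1, V w⟫ 1) = W (W G + m 1)`. -/
theorem exists_stationary {ℓ T c k : ℝ} (hℓ : 0 < ℓ) (hT : 0 ≤ T) (hc : 0 ≤ c) (hk : 0 ≤ k)
    (G : L2 0 ℓ) (m : ℝ) :
    ∃ y ∈ sobolev 0 ℓ 4, contRep 0 ℓ y 0 = 0 ∧ contRep 0 ℓ (wderiv y) 0 = 0 ∧
      contRep 0 ℓ (wderiv (wderiv y)) ℓ = 0 ∧
      contRep 0 ℓ (wderiv (wderiv (wderiv y))) ℓ - T * contRep 0 ℓ (wderiv y) ℓ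
        = k * contRep 0 ℓ y ℓ - m ∧
      wderiv (wderiv (wderiv (wderiv y))) - T • wderiv (wderiv y) + c • y = G := by
  have h0 : (0 : ℝ) ∈ Icc 0 ℓ := left_mem_Icc.2 hℓ.le
  have hl : ℓ ∈ Icc 0 ℓ := right_mem_Icc.2 hℓ.le
  obtain ⟨V, hV⟩ := exists_volterra hℓ
  set e : L2 0 ℓ := oneL2 0 ℓ with he
  have hVl : ∀ g, contRep 0 ℓ (V g) ℓ = inner ℝ e g := fun g => by
    have := hasWeakDeriv_oneL2.inner_eq hℓ (hV g).1
    rw [contRep_oneL2 hℓ hl, contRep_oneL2 hℓ h0, (hV g).2, inner_zero_left] at this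
    rw [he, this]; ring
  let I : L2 0 ℓ →L[ℝ] L2 0 ℓ := (innerSL ℝ e).smulRight e
  have hI : ∀ g, I g = (inner ℝ e g : ℝ) • e := fun g => by simp [I]
  let W : L2 0 ℓ →L[ℝ] L2 0 ℓ := I - V
  have hWd : ∀ g, HasWeakDeriv 0 ℓ (W g) (-g : L2 0 ℓ) := fun g => by
    have := (hasWeakDeriv_oneL2.coe_smul (inner ℝ e g)).coe_sub (hV g).1
    rw [smul_zero, zero_sub] at this
    simpa [W, hI] using this
  have hWl : ∀ g, contRep 0 ℓ (W g) ℓ = 0 := fun g => by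
    have e1 : W g = (inner ℝ e g : ℝ) • e - V g := by simp [W, hI]
    rw [e1, contRep_sub hℓ (Submodule.smul_mem _ _ hasWeakDeriv_oneL2.mem_sobolev_one)
      (hV g).1.mem_sobolev_one hl, contRep_smul hℓ _ hasWeakDeriv_oneL2.mem_sobolev_one hl,
      contRep_oneL2 hℓ hl, hVl]
    ring
  have hadj : ∀ g φ, inner ℝ (W g) φ = inner ℝ g (V φ) := fun g φ => by
    have := (hWd g).inner_eq hℓ (hV φ).1
    rw [hWl, (hV φ).2, inner_neg_left] at this
    rw [this]; ring
  let M : L2 0 ℓ →L[ℝ] L2 0 ℓ :=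
    ContinuousLinearMap.id ℝ _ + W.comp (T • V + c • W.comp (V.comp V) + k • I.comp V)
  have hMa : ∀ w, M w = w + W (T • V w + c • W (V (V w)) + k • I (V w)) := fun w => rfl
  obtain ⟨w, hw⟩ := surjective_of_coercive M (fun w => by
    rw [hMa, inner_add_left, hadj, inner_add_left, inner_add_left, real_inner_smul_left,
      real_inner_smul_left, real_inner_smul_left, hadj, hI, real_inner_smul_left,
      real_inner_self_eq_norm_sq, real_inner_self_eq_norm_sq, real_inner_self_eq_norm_sq]
    have := mul_nonneg hT (sq_nonneg ‖V w‖)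
    have := mul_nonneg hc (sq_nonneg ‖V (V w)‖)
    have := mul_nonneg hk (mul_self_nonneg (inner ℝ e (V w)))
    linarith) (W (W G + m • e))
  set y := V (V w) with hy
  -- `q = -y'''`
  set q : L2 0 ℓ := W (G - c • y) - T • V w + (m - k * inner ℝ e (V w)) • e with hq
  have hwq : w = W q := by
    have h1 : w = W (W G + m • e) - W (T • V w + c • W y + k • I (V w)) := by
      rw [← hw, hMa]; abel
    have h2 : W (G - c • y) = W G - c • W y := by rw [map_sub, map_smul]
    rw [h1, ← map_sub, hq, hI, h2, sub_smul, smul_smul]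
    congr 1; abel
  have d1 : HasWeakDeriv 0 ℓ y (V w) := (hV _).1
  have d2 : HasWeakDeriv 0 ℓ (V w) w := (hV _).1
  have d3 : HasWeakDeriv 0 ℓ w (-q : L2 0 ℓ) := by
    have := hWd q
    rwa [← hwq] at this
  have dq : HasWeakDeriv 0 ℓ q (-(G - c • y) - T • w + (m - k * inner ℝ e (V w)) • 0 : L2 0 ℓ) :=
    ((hWd _).coe_sub (d2.coe_smul T)).coe_add (hasWeakDeriv_oneL2.coe_smul _)
  have d4 : HasWeakDeriv 0 ℓ (-q : L2 0 ℓ) (G - c • y + T • w : L2 0 ℓ) := by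
    have := dq.coe_smul (-1)
    have e1 : (-1 : ℝ) • (-(G - c • y) - T • w + (m - k * inner ℝ e (V w)) • 0)
        = G - c • y + T • w := by
      rw [smul_zero, neg_one_smul]; abel
    rwa [e1, neg_one_smul] at this
  have s1 := hWd (G - c • y)
  have hql : contRep 0 ℓ q ℓ = - T * contRep 0 ℓ (V w) ℓ + (m - k * inner ℝ e (V w)) := by
    have m2 := Submodule.smul_mem _ T d2.mem_sobolev_one
    have m3 := Submodule.smul_mem _ (m - k * inner ℝ e (V w))
      (hasWeakDeriv_oneL2 (a := 0) (b := ℓ)).mem_sobolev_one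
    rw [hq, contRep_add hℓ (sub_mem s1.mem_sobolev_one m2) m3 hl,
      contRep_sub hℓ s1.mem_sobolev_one m2 hl, contRep_smul hℓ _ d2.mem_sobolev_one hl,
      contRep_smul hℓ _ hasWeakDeriv_oneL2.mem_sobolev_one hl, contRep_oneL2 hℓ hl, hWl]
    ring
  refine ⟨y, d1.mem_sobolev (d2.mem_sobolev (d3.mem_sobolev d4.mem_sobolev_one)), (hV _).2, ?_⟩
  rw [wderiv_eq d1, wderiv_eq d2, wderiv_eq d3, wderiv_eq d4]
  refine ⟨(hV _).2, by rw [hwq]; exact hWl q, ?_, by abel⟩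
  rw [← neg_one_smul ℝ q, contRep_smul hℓ _ dq.mem_sobolev_one hl, hql, hy, hVl (V w)]
  ring

/-! ### The transport equation in the delay variable -/

section transport

variable {ℓ : ℝ}

theorem HasWeakDeriv.smooth_mul {a b : ℝ} {f g e : ℝ → ℝ} (he : ContDiff ℝ ∞ e)
    (h : HasWeakDeriv a b f g) :
    HasWeakDeriv a b (fun x => e x * f x) (fun x => e x * g x + deriv e x * f x) := by
  have hb : ∀ {e f : ℝ → ℝ}, Continuous e → Integrable f (leb a b) →
      Integrable (fun x => e x * f x) (leb a b) := fun he hf =>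
    IntegrableOn.continuousOn_mul_of_subset he.continuousOn hf isCompact_Icc measurableSet_Ioo
      Ioo_subset_Icc_self
  have hed : ContDiff ℝ ∞ (deriv e) := (contDiff_infty_iff_deriv.1 he).2
  have hde : ∀ x, DifferentiableAt ℝ e x := (contDiff_infty_iff_deriv.1 he).1
  refine ⟨hb he.continuous h.1, (hb he.continuous h.2.1).add (hb hed.continuous h.1),
    fun φ hφ => ?_⟩
  have hdφ : ∀ x, DifferentiableAt ℝ φ x := (contDiff_infty_iff_deriv.1 hφ.1).1
  have ht : IsTest a b fun x => e x * φ x :=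
    ⟨he.mul hφ.1, hφ.2.1.mul_left, (tsupport_mul_subset_right).trans hφ.2.2⟩
  have key := h.2.2 _ ht
  have e1 : ∀ x, deriv (fun x => e x * φ x) x = deriv e x * φ x + e x * deriv φ x := fun x =>
    ((hde x).hasDerivAt.mul (hdφ x).hasDerivAt).deriv
  have i1 := hφ.integrable_mul (hb hed.continuous h.1)
  have i2 := hφ.deriv.integrable_mul (hb he.continuous h.1)
  have i3 := hφ.integrable_mul (hb he.continuous h.2.1)
  have e2 : ∫ x in Ioo a b, f x * deriv (fun x => e x * φ x) x
      = (∫ x in Ioo a b, deriv e x * f x * φ x) + ∫ x in Ioo a b, e x * f x * deriv φ x := by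
    rw [← integral_add i1 i2]
    exact integral_congr_ae (Eventually.of_forall fun x => by simp only [e1]; ring)
  have e3 : ∫ x in Ioo a b, (e x * g x + deriv e x * f x) * φ x
      = (∫ x in Ioo a b, e x * g x * φ x) + ∫ x in Ioo a b, deriv e x * f x * φ x := by
    rw [← integral_add i3 i1]
    exact integral_congr_ae (Eventually.of_forall fun x => by ring)
  have e4 : ∫ x in Ioo a b, g x * (e x * φ x) = ∫ x in Ioo a b, e x * g x * φ x :=
    integral_congr_ae (Eventually.of_forall fun x => by ring)
  rw [e2, e4] at key
  rw [e3]
  linarith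

/-- Duhamel's formula for `U' = g - μ U`, `U(0) = c`. -/
theorem hasWeakDeriv_duhamel {g : ℝ → ℝ} (hg : Integrable g (leb 0 1)) (c μ : ℝ) :
    HasWeakDeriv 0 1
      (fun s => Real.exp (-μ * s) * (c + ∫ r in (0 : ℝ)..s, Real.exp (μ * r) * g r))
      (fun s => g s
        - μ * (Real.exp (-μ * s) * (c + ∫ r in (0 : ℝ)..s, Real.exp (μ * r) * g r))) ∧
    ContinuousOn
      (fun s => Real.exp (-μ * s) * (c + ∫ r in (0 : ℝ)..s, Real.exp (μ * r) * g r))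
      (Icc 0 1) := by
  have hk : Integrable (fun r => Real.exp (μ * r) * g r) (leb 0 1) :=
    IntegrableOn.continuousOn_mul_of_subset
      (by fun_prop : Continuous fun r => Real.exp (μ * r)).continuousOn hg
      isCompact_Icc measurableSet_Ioo Ioo_subset_Icc_self
  have hc : HasWeakDeriv 0 1 (fun _ => c) (fun _ => 0) := by
    refine ((hasWeakDeriv_oneL2 (a := 0) (b := 1)).smul c).congr ?_ ?_
    · filter_upwards [oneL2_ae (a := 0) (b := 1)] with x hx; rw [hx, mul_one]
    · filter_upwards [Lp.coeFn_zero ℝ 2 (leb 0 1)] with x hx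
      rw [hx, Pi.zero_apply, mul_zero]
  have h := (hc.add (HasWeakDeriv.of_primitive one_pos hk)).smooth_mul
    (e := fun s => Real.exp (-μ * s)) (by fun_prop)
  refine ⟨h.congr (ae_eq_refl _) (Eventually.of_forall fun s => ?_), ?_⟩
  · have hd : deriv (fun s => Real.exp (-μ * s)) s = Real.exp (-μ * s) * (-μ * 1) :=
      (((hasDerivAt_id s).const_mul (-μ)).exp).deriv
    have he : Real.exp (-μ * s) * Real.exp (μ * s) = 1 := by
      rw [← Real.exp_add, Real.exp_eq_one_iff]; ring
    simp only [hd]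
    linear_combination (-g s) * he
  · exact (by fun_prop : Continuous fun s => Real.exp (-μ * s)).continuousOn.mul
      (continuousOn_const.add (continuousOn_primitive one_pos hk))

theorem memLp_fibre_integral {k : ℝ × ℝ → ℝ} (hk : MemLp k 2 (lebQ ℓ)) :
    MemLp (fun x => ∫ s in Ioo (0 : ℝ) 1, k (x, s)) 2 (leb 0 ℓ) := by
  have hmeas : AEStronglyMeasurable (fun x => ∫ s in Ioo (0 : ℝ) 1, k (x, s)) (leb 0 ℓ) :=
    hk.1.integral_prod_right'
  rw [memLp_two_iff_integrable_sq hmeas]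
  have hk2 : Integrable (fun z => k z ^ 2) (lebQ ℓ) := hk.integrable_sq
  have hk1 : Integrable k (lebQ ℓ) := hk.integrable one_le_two
  refine hk2.integral_prod_left.mono' (hmeas.pow 2) ?_
  filter_upwards [hk1.prod_right_ae, hk2.prod_right_ae] with x hx1 hx2
  rw [Real.norm_eq_abs, abs_of_nonneg (sq_nonneg _)]
  set m := ∫ s in Ioo (0 : ℝ) 1, k (x, s) with hm
  -- the variance of `k (x, ·)` is nonnegative
  have hnn : 0 ≤ ∫ s in Ioo (0 : ℝ) 1, (k (x, s) - m) ^ 2 := integral_nonneg fun _ => sq_nonneg _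
  have hexp : ∫ s in Ioo (0 : ℝ) 1, (k (x, s) - m) ^ 2
      = (∫ s in Ioo (0 : ℝ) 1, k (x, s) ^ 2) - m ^ 2 := by
    have : ∀ s, (k (x, s) - m) ^ 2 = k (x, s) ^ 2 - 2 * m * k (x, s) + m ^ 2 := fun s => by ring
    simp only [this]
    have hx3 : Integrable (fun s => k (x, s) ^ 2 - 2 * m * k (x, s)) (leb 0 1) :=
      hx2.sub (hx1.const_mul _)
    rw [integral_add hx3 (integrable_const _),
      integral_sub hx2 (hx1.const_mul _), integral_const_mul, ← hm]
    simp
    ring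
  linarith

theorem ae_snd_mem : ∀ᵐ z : ℝ × ℝ ∂(lebQ ℓ), z.2 ∈ Ioo (0 : ℝ) 1 :=
  (Measure.ae_prod_iff_ae_ae (measurable_snd measurableSet_Ioo)).2
    (Eventually.of_forall fun _ => ae_restrict_mem measurableSet_Ioo)

theorem exp_mul_le {μ s : ℝ} (hs : s ∈ Ioo (0 : ℝ) 1) : Real.exp (μ * s) ≤ Real.exp |μ| := by
  refine Real.exp_le_exp.2 ((le_abs_self _).trans ?_)
  rw [abs_mul, abs_of_pos hs.1]
  exact mul_le_of_le_one_right (abs_nonneg _) hs.2.le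

/-- Joint measurability of `∫₀ˢ` in `(x, s)` is obtained by writing it as the integral over `(0, 1)`
of the integrand cut off at `s`. -/
theorem memLp_duhamel (h : L2Q ℓ) (v : L2 0 ℓ) (μ : ℝ) :
    MemLp (fun z : ℝ × ℝ => Real.exp (-μ * z.2) *
      (v z.1 + ∫ r in (0 : ℝ)..z.2, Real.exp (μ * r) * h (z.1, r))) 2 (lebQ ℓ) := by
  set k : ℝ × ℝ → ℝ := fun z => Real.exp (μ * z.2) * h z with hk
  have hkm : StronglyMeasurable k :=
    (by fun_prop : Continuous fun z : ℝ × ℝ => Real.exp (μ * z.2)).stronglyMeasurable.mul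
      (Lp.stronglyMeasurable h)
  have hkL : MemLp k 2 (lebQ ℓ) := by
    refine (Lp.memLp h).of_le_mul (c := Real.exp |μ|) hkm.aestronglyMeasurable ?_
    filter_upwards [ae_snd_mem] with z hz
    rw [hk, norm_mul, Real.norm_of_nonneg (Real.exp_pos _).le]
    exact mul_le_mul_of_nonneg_right (exp_mul_le hz) (norm_nonneg _)
  have hmeas : StronglyMeasurable fun z : ℝ × ℝ => ∫ r in Ioo (0 : ℝ) 1,
      {q : (ℝ × ℝ) × ℝ | q.2 ≤ q.1.2}.indicator (fun q => k (q.1.1, q.2)) (z, r) := by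
    refine StronglyMeasurable.integral_prod_right' (f := fun q : (ℝ × ℝ) × ℝ =>
      {q : (ℝ × ℝ) × ℝ | q.2 ≤ q.1.2}.indicator (fun q => k (q.1.1, q.2)) q) ?_
    exact (hkm.comp_measurable (by fun_prop)).indicator
      (measurableSet_le (by fun_prop) (by fun_prop))
  have hval : ∀ z : ℝ × ℝ, z.2 ∈ Ioo (0 : ℝ) 1 → ∫ r in (0 : ℝ)..z.2, k (z.1, r)
      = ∫ r in Ioo (0 : ℝ) 1,
        {q : (ℝ × ℝ) × ℝ | q.2 ≤ q.1.2}.indicator (fun q => k (q.1.1, q.2)) (z, r) := by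
    intro z hz
    have e : (fun r => {q : (ℝ × ℝ) × ℝ | q.2 ≤ q.1.2}.indicator (fun q => k (q.1.1, q.2)) (z, r))
        = (Iic z.2).indicator fun r => k (z.1, r) := by
      funext r
      simp [indicator]
    rw [e, setIntegral_indicator measurableSet_Iic, intervalIntegral.integral_of_le hz.1.le]
    congr 2
    ext r
    simp only [mem_Ioc, mem_inter_iff, mem_Ioo, mem_Iic]
    exact ⟨fun h => ⟨⟨h.1, h.2.trans_lt hz.2⟩, h.2⟩, fun h => ⟨h.1.1, h.2⟩⟩
  have hU : MemLp (fun z : ℝ × ℝ => Real.exp (-μ * z.2) * (v z.1 + ∫ r in Ioo (0 : ℝ) 1,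
      {q : (ℝ × ℝ) × ℝ | q.2 ≤ q.1.2}.indicator (fun q => k (q.1.1, q.2)) (z, r))) 2 (lebQ ℓ) := by
    have hb : MemLp (fun z : ℝ × ℝ => ‖v z.1‖ + ∫ s in Ioo (0 : ℝ) 1, ‖k (z.1, s)‖) 2 (lebQ ℓ) :=
      ((Lp.memLp v).norm.add (memLp_fibre_integral hkL.norm)).comp_fst (leb 0 1)
    refine hb.of_le_mul (c := Real.exp |-μ|) ?_ ?_
    · refine (StronglyMeasurable.mul (by fun_prop : Continuous fun z : ℝ × ℝ =>
        Real.exp (-μ * z.2)).stronglyMeasurable ?_).aestronglyMeasurable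
      exact ((Lp.stronglyMeasurable v).comp_measurable measurable_fst).add hmeas
    · have hk1 := (hkL.integrable one_le_two).prod_right_ae
      have hk2 : ∀ᵐ z : ℝ × ℝ ∂(lebQ ℓ), Integrable (fun s => k (z.1, s)) (leb 0 1) :=
        Measure.quasiMeasurePreserving_fst.ae hk1
      filter_upwards [ae_snd_mem, hk2] with z hz hkz
      rw [norm_mul, Real.norm_of_nonneg (Real.exp_pos _).le, Real.norm_of_nonneg
        (add_nonneg (norm_nonneg _) (integral_nonneg fun _ => norm_nonneg _))]
      refine mul_le_mul (exp_mul_le hz) ((norm_add_le _ _).trans (add_le_add_right ?_ _))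
        (norm_nonneg _) (Real.exp_pos _).le
      refine norm_integral_le_of_norm_le hkz.norm (Eventually.of_forall fun r => ?_)
      simp only [indicator]
      split_ifs
      · exact le_rfl
      · rw [norm_zero]; exact norm_nonneg _
  refine (memLp_congr_ae ?_).1 hU
  filter_upwards [ae_snd_mem] with z hz
  rw [← hval z hz]

/-- The transport problem `u_s = h - μ u`, `u(·, 0) = v`, whose value at `s = 1` is an affine
function of `v`. -/
theorem exists_transport (h : L2Q ℓ) (μ : ℝ) : ∃ z : L2 0 ℓ, ∀ v : L2 0 ℓ, ∃ u : L2Q ℓ,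
    HasWeakDerivS u (h - μ • u) ∧ v =ᵐ[leb 0 ℓ] fibreVal u 0 ∧
      traceOne u = Real.exp (-μ) • v + z := by
  have main : ∀ v : L2 0 ℓ, ∃ u : L2Q ℓ, HasWeakDerivS u (h - μ • u) ∧
      v =ᵐ[leb 0 ℓ] fibreVal u 0 ∧ traceOne u =ᵐ[leb 0 ℓ] fun x =>
        Real.exp (-μ) * (v x + ∫ r in (0 : ℝ)..1, Real.exp (μ * r) * h (x, r)) := by
    intro v
    have hm := memLp_duhamel h v μ
    set u : L2Q ℓ := hm.toLp with hu
    have hfib : ∀ᵐ x ∂(leb 0 ℓ), (fun s => u (x, s)) =ᵐ[leb 0 1] fun s =>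
        Real.exp (-μ * s) * (v x + ∫ r in (0 : ℝ)..s, Real.exp (μ * r) * h (x, r)) :=
      Measure.ae_ae_of_ae_prod hm.coeFn_toLp
    have hfib2 : ∀ᵐ x ∂(leb 0 ℓ), (fun s => (h - μ • u : L2Q ℓ) (x, s)) =ᵐ[leb 0 1] fun s =>
        h (x, s) - μ * u (x, s) := by
      refine Measure.ae_ae_of_ae_prod (p := fun z => (h - μ • u : L2Q ℓ) z = h z - μ * u z) ?_
      filter_upwards [Lp.coeFn_sub h (μ • u), Lp.coeFn_smul μ u] with z h1 h2
      rw [h1, Pi.sub_apply, h2, Pi.smul_apply, smul_eq_mul]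
    have hint : ∀ᵐ x ∂(leb 0 ℓ), Integrable (fun s => h (x, s)) (leb 0 1) :=
      ((Lp.memLp h).integrable one_le_two).prod_right_ae
    have hder : HasWeakDerivS u (h - μ • u) := by
      filter_upwards [hfib, hfib2, hint] with x h1 h2 h3
      refine (hasWeakDeriv_duhamel h3 (v x) μ).1.congr h1 (h2.trans ?_)
      filter_upwards [h1] with s hs
      rw [hs]
    refine ⟨u, hder, ?_, (traceOne_ae ⟨_, hder⟩).trans ?_⟩
    · filter_upwards [hfib, hint] with x h1 h3
      rw [fibreVal, contRep_eqOn one_pos ⟨(hasWeakDeriv_duhamel h3 (v x) μ).2, h1⟩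
        (left_mem_Icc.2 zero_le_one)]
      simp
    · filter_upwards [hfib, hint] with x h1 h3
      rw [fibreVal, contRep_eqOn one_pos ⟨(hasWeakDeriv_duhamel h3 (v x) μ).2, h1⟩
        (right_mem_Icc.2 zero_le_one)]
      simp only [mul_one]
  obtain ⟨u₀, -, -, h0⟩ := main 0
  refine ⟨traceOne u₀, fun v => ?_⟩
  obtain ⟨u, h1, h2, h3⟩ := main v
  refine ⟨u, h1, h2, Lp.ext ?_⟩
  filter_upwards [h0, h3, Lp.coeFn_zero ℝ 2 (leb 0 ℓ), Lp.coeFn_add (Real.exp (-μ) • v)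
    (traceOne u₀), Lp.coeFn_smul (Real.exp (-μ)) v] with x e0 e3 ez ea es
  rw [ea, Pi.add_apply, es, Pi.smul_apply, e0, e3, ez, Pi.zero_apply, smul_eq_mul]
  ring

/-- Integration by parts in the delay variable: `2 ∫∫ u u_s = ∫ u(·, 1)² - ∫ u(·, 0)²`. -/
theorem two_mul_inner_sderiv {u : L2Q ℓ} (hu : InL2H1 u) {v : L2 0 ℓ}
    (hv : v =ᵐ[leb 0 ℓ] fibreVal u 0) :
    2 * inner ℝ u (sderiv u) = ‖traceOne u‖ ^ 2 - ‖v‖ ^ 2 := by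
  have hi : Integrable (fun z => u z * sderiv u z) (lebQ ℓ) := by
    refine (MeasureTheory.L2.integrable_inner (𝕜 := ℝ) u (sderiv u)).congr
      (Eventually.of_forall fun z => ?_)
    simp [mul_comm]
  have e1 : inner ℝ u (sderiv u) = ∫ z, u z * sderiv u z ∂(lebQ ℓ) := by
    rw [MeasureTheory.L2.inner_def]
    exact integral_congr_ae (Eventually.of_forall fun z => by simp [mul_comm])
  have hsq : ∀ f : L2 0 ℓ, Integrable (fun x => f x * f x) (leb 0 ℓ) := fun f =>
    (MeasureTheory.L2.integrable_inner (𝕜 := ℝ) f f).congr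
      (Eventually.of_forall fun z => by simp [sq])
  rw [e1, integral_prod _ hi, ← real_inner_self_eq_norm_sq, ← real_inner_self_eq_norm_sq,
    L2.inner_eq_integral, L2.inner_eq_integral, ← integral_const_mul,
    ← integral_sub (hsq _) (hsq _)]
  refine integral_congr_ae ?_
  filter_upwards [hu.hasWeakDerivS, hv, traceOne_ae hu] with x h1 h2 h3
  have key := h1.integral_mul_eq one_pos h1
  have e2 : ∫ s in Ioo (0 : ℝ) 1, sderiv u (x, s) * u (x, s)
      = ∫ s in Ioo (0 : ℝ) 1, u (x, s) * sderiv u (x, s) :=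
    integral_congr_ae (Eventually.of_forall fun s => mul_comm _ _)
  rw [e2] at key
  rw [h2, h3]
  simp only [fibreVal]
  linarith

end transport

/-! ### The beam operator is quasi-m-dissipative -/

theorem State.inner_eq {p : Params} (Y Z : State p) :
    inner ℝ Y Z = inner ℝ Y.v Z.v + p.T * inner ℝ (wderiv Y.y) (wderiv Z.y)
      + inner ℝ (wderiv (wderiv Y.y)) (wderiv (wderiv Z.y)) + p.ξ * inner ℝ Y.u Z.u := rfl

theorem State.norm_v_sq_le {p : Params} (Y : State p) : ‖Y.v‖ ^ 2 ≤ ‖Y‖ ^ 2 := by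
  have := p.T_pos
  have := p.ξ_pos
  rw [Y.norm_sq]
  have h1 : 0 ≤ p.T * ‖wderiv Y.y‖ ^ 2 := by positivity
  have h2 : 0 ≤ p.ξ * ‖Y.u‖ ^ 2 := by positivity
  nlinarith [sq_nonneg ‖wderiv (wderiv Y.y)‖]

/-- The energy balance: the boundary feedback dissipates `κ v(ℓ)²`, and the delay term is
absorbed by the flux `ξ / (2 τ) ∫ u(·, 1)²`, at the cost of a multiple of `∫ v²`. -/
theorem inner_opA_le (p : Params) (Y : (opA p).domain) :
    inner ℝ (opA p Y) (Y : State p)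
      ≤ (p.ξ / (2 * p.τ) + p.α ^ 2 / (4 * (p.ξ / (2 * p.τ)))) * ‖(Y : State p)‖ ^ 2 := by
  obtain ⟨Y, hY⟩ := Y
  obtain ⟨hy, hv, hu, hvu, hb2, hb3⟩ := hY
  have hℓ := p.ℓ_pos
  have hτ := p.τ_pos
  have hξ := p.ξ_pos
  set q : ℝ := p.ξ / (2 * p.τ) with hq
  have hq0 : 0 < q := by positivity
  have d1 := hasWeakDeriv_wderiv hy
  have d2 := hasWeakDeriv_wderiv (wderiv_mem hy)
  have d3 := hasWeakDeriv_wderiv (wderiv_mem (wderiv_mem hy))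
  have d4 := hasWeakDeriv_wderiv (wderiv_mem (wderiv_mem (wderiv_mem hy)))
  have f1 := hasWeakDeriv_wderiv hv.1
  have f2 := hasWeakDeriv_wderiv (wderiv_mem hv.1)
  have i1 := f1.inner_eq hℓ d4
  have i2 := f2.inner_eq hℓ d3
  have i3 := f1.inner_eq hℓ d2
  rw [hv.2.1] at i1 i3
  rw [hv.2.2, hb2] at i2
  have i4 := two_mul_inner_sderiv hu hvu
  have e : inner ℝ (opA p ⟨Y, hy, hv, hu, hvu, hb2, hb3⟩) Y
      = inner ℝ (opV p Y.y Y.u) Y.v + p.T * inner ℝ (wderiv Y.v) (wderiv Y.y)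
        + inner ℝ (wderiv (wderiv Y.v)) (wderiv (wderiv Y.y)) + p.ξ * inner ℝ (opU p Y.u) Y.u :=
    rfl
  have eV : inner ℝ (opV p Y.y Y.u) Y.v
      = - inner ℝ Y.v (wderiv (wderiv (wderiv (wderiv Y.y))))
        + p.T * inner ℝ Y.v (wderiv (wderiv Y.y)) - p.α * inner ℝ (traceOne Y.u) Y.v := by
    rw [opV, inner_sub_left, inner_add_left, inner_neg_left, real_inner_smul_left,
      real_inner_smul_left, real_inner_comm Y.v, real_inner_comm Y.v]
  have eU : p.ξ * inner ℝ (opU p Y.u) Y.u = - q * (2 * inner ℝ Y.u (sderiv Y.u)) := by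
    rw [opU, inner_neg_left, real_inner_smul_left, real_inner_comm Y.u, hq]
    field_simp
  have hflux : - (p.κ * contRep 0 p.ℓ Y.v p.ℓ ^ 2) ≤ 0 := by
    have := p.κ_pos
    have : 0 ≤ p.κ * contRep 0 p.ℓ Y.v p.ℓ ^ 2 := by positivity
    linarith
  -- Young's inequality
  have hyoung : - (p.α * inner ℝ (traceOne Y.u) Y.v)
      ≤ q * ‖traceOne Y.u‖ ^ 2 + p.α ^ 2 / (4 * q) * ‖Y.v‖ ^ 2 := by
    have h1 : - (p.α * inner ℝ (traceOne Y.u) Y.v) ≤ |p.α| * (‖traceOne Y.u‖ * ‖Y.v‖) := by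
      refine (neg_le_abs _).trans ?_
      rw [abs_mul]
      exact mul_le_mul_of_nonneg_left (abs_real_inner_le_norm _ _) (abs_nonneg _)
    have h2 : 0 ≤ q * (‖traceOne Y.u‖ - |p.α| / (2 * q) * ‖Y.v‖) ^ 2 := by positivity
    have h3 : q * (‖traceOne Y.u‖ - |p.α| / (2 * q) * ‖Y.v‖) ^ 2
        = q * ‖traceOne Y.u‖ ^ 2 + p.α ^ 2 / (4 * q) * ‖Y.v‖ ^ 2
          - |p.α| * (‖traceOne Y.u‖ * ‖Y.v‖) := by
      rw [← sq_abs p.α]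
      field_simp
      ring
    linarith
  have hle : (q + p.α ^ 2 / (4 * q)) * ‖Y.v‖ ^ 2 ≤ (q + p.α ^ 2 / (4 * q)) * ‖Y‖ ^ 2 :=
    mul_le_mul_of_nonneg_left Y.norm_v_sq_le (by positivity)
  rw [e, eV, eU, i1, i2, i3, i4]
  refine le_trans (le_of_eq ?_) (le_trans (add_le_add (add_le_add hflux hyoung)
    (le_refl (-q * (‖traceOne Y.u‖ ^ 2 - ‖Y.v‖ ^ 2)))) (le_trans (le_of_eq ?_) hle))
  · linear_combination (- contRep 0 p.ℓ Y.v p.ℓ) * hb3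
  · ring

/-- Eliminating `v = r y - f` and `u`, the resolvent equation `(r - 𝔸) (y, v, u) = (f, g, h)`
becomes the stationary beam equation for `y` with `c = r² + α r e^{-rτ}`, which is nonnegative
for `r ≥ |α|`. -/
theorem exists_resolvent_opA (p : Params) {r : ℝ} (hr : |p.α| < r) (F : State p) :
    ∃ Y : (opA p).domain, r • (Y : State p) - opA p Y = F := by
  have hℓ := p.ℓ_pos
  have hτ := p.τ_pos
  have hr0 : 0 < r := (abs_nonneg _).trans_lt hr
  have h0 : (0 : ℝ) ∈ Icc 0 p.ℓ := left_mem_Icc.2 hℓ.le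
  have hl : p.ℓ ∈ Icc 0 p.ℓ := right_mem_Icc.2 hℓ.le
  have hF := F.y_mem
  obtain ⟨z, hz⟩ := exists_transport (p.τ • F.u) (r * p.τ)
  set E : ℝ := Real.exp (-(r * p.τ)) with hE
  have hE0 : 0 < E := Real.exp_pos _
  have hE1 : E ≤ 1 := Real.exp_le_one_iff.2 (by nlinarith)
  have hc : 0 ≤ r ^ 2 + p.α * r * E := by
    have h1 : -r ≤ p.α * E := by
      have h2 : |p.α * E| ≤ |p.α| := by
        rw [abs_mul, abs_of_pos hE0]
        exact mul_le_of_le_one_right (abs_nonneg _) hE1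
      linarith [neg_abs_le (p.α * E)]
    nlinarith
  obtain ⟨y, hy, hy0, hy1, hb2, hb3, heq⟩ := exists_stationary (k := p.κ * r) hℓ p.T_pos.le hc
    (mul_pos p.κ_pos hr0).le (F.v + r • F.y + (p.α * E) • F.y - p.α • z)
    (p.κ * contRep 0 p.ℓ F.y p.ℓ)
  have hy2 : y ∈ sobolev 0 p.ℓ 2 :=
    (hasWeakDeriv_wderiv hy).mem_sobolev ((hasWeakDeriv_wderiv (wderiv_mem hy)).mem_sobolev_one)
  have hyE : y ∈ H2E p := ⟨hy2, hy0, hy1⟩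
  set v : L2 0 p.ℓ := r • y - F.y with hv
  have hvE : v ∈ H2E p := sub_mem (Submodule.smul_mem _ r hyE) hF
  have hvl : contRep 0 p.ℓ v p.ℓ = r * contRep 0 p.ℓ y p.ℓ - contRep 0 p.ℓ F.y p.ℓ := by
    rw [hv, contRep_sub hℓ (Submodule.smul_mem _ r hy2) hF.1 hl, contRep_smul hℓ r hy2 hl]
  obtain ⟨u, hu, hu0, hu1⟩ := hz v
  refine ⟨⟨State.mk ⟨y, hyE⟩ v u, hy, hvE, ⟨_, hu⟩, hu0, hb2, ?_⟩, State.ext ?_ ?_ ?_⟩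
  · simp only [State.y_mk, State.v_mk]
    rw [hb3, hvl]; ring
  · change r • y - v = F.y
    rw [hv]; abel
  · change r • v - opV p y u = F.v
    rw [opV, hu1]
    have h4 : wderiv (wderiv (wderiv (wderiv y))) = p.T • wderiv (wderiv y)
        - (r ^ 2 + p.α * r * E) • y + (F.v + r • F.y + (p.α * E) • F.y - p.α • z) := by
      rw [← heq]; abel
    rw [h4, hv]
    module
  · change r • u - opU p u = F.u
    rw [opU, sderiv_eq hu, smul_sub, smul_smul, smul_smul, inv_mul_cancel₀ hτ.ne', one_smul,
      mul_comm r, inv_mul_cancel_left₀ hτ.ne']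
    abel

theorem isQuasiMDissipative_opA (p : Params) : ∃ γ, 0 ≤ γ ∧ IsQuasiMDissipative (opA p) γ := by
  have hτ := p.τ_pos
  have hξ := p.ξ_pos
  set γ : ℝ := p.ξ / (2 * p.τ) + p.α ^ 2 / (4 * (p.ξ / (2 * p.τ))) with hγ
  have hγ0 : 0 ≤ γ := by positivity
  refine ⟨γ + |p.α|, by positivity, ⟨fun Y => ?_, fun r hr => ?_⟩⟩
  · exact (inner_opA_le p Y).trans
      (mul_le_mul_of_nonneg_right (le_add_of_nonneg_right (abs_nonneg _)) (sq_nonneg _))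
  · exact exists_resolvent_opA p (by linarith)

end Beam

theorem theorem1 (p : Beam.Params) :
    ∃ S : Beam.C0Semigroup (Beam.State p),
      Beam.IsGenerator (Beam.opA p) S ∧
      ∀ Y₀ : Beam.State p, ∃ Y : ℝ → Beam.State p,
        Beam.IsMildSolution (Beam.opA p) Y₀ Y ∧
        (∀ Z : ℝ → Beam.State p, Beam.IsMildSolution (Beam.opA p) Y₀ Z →
          Set.EqOn Z Y (Set.Ici 0)) ∧
        (∀ t : NNReal, Y t = S.op t Y₀) ∧
        (Y₀ ∈ (Beam.opA p).domain → Beam.IsClassicalSolution (Beam.opA p) Y₀ Y) := by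
  obtain ⟨γ, hγ, hA⟩ := Beam.isQuasiMDissipative_opA p
  exact hA.wellPosed hγ
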